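/- Let $B\ge 2$, $N\ge 1$, $K\ge 1$, $0\le t\le K$ be integers and $M=tN/K$. Cache-aided multi-user private information retrieval (MuPIR): $N$ independent, uniformly distributed files of $L$ bits are replicated on $B$ non-colluding servers; each of $K$ users has a cache, filled with a function $\mathcal Z_k$ of the files with $H(\mathcal Z_k)\le ML$ before the demands are known. For a demand vector $\mathbf d=(d_1,\dots,d_K)$ the users jointly draw, independently of the files, queries $Q_1,\dots,Q_B$, whose joint law depends on $\mathbf d$ but such that the law of each single $Q_b$ does not depend on $\mathbf d$ (privacy). Server $b$ broadcasts an answer that is a function of $Q_b$ and the files, of a length determined by $Q_b$; every user $k$ must recover file $d_k$ without error from all queries, all answers and its cache. The rate is the expected total number of broadcast bits divided by $L$ (for the worst $\mathbf d$; by privacy it is the same for all $\mathbf d$). Let $R^*(M)$ be the infimum of the rates of such schemes, over all $L\ge 1$, and $R^*_u(M)$ the same infimum over the schemes with uncoded placement (each cache stores a set of raw bits of the files). Coded caching: one server, no privacy, caches of at most $ML$ bits, a broadcast of at most $RL$ bits for every demand vector, depending on $\mathbf d$ and the files, zero error. Let $R^*_{cc}(M)$ be the infimum of the achievable $R$ over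 all $L\ge1$, and $R^*_{ucc}(M)$ the same infimum under uncoded placement. The Maddah-Ali–Niesen placement delivery array has the $t$-subsets $T$ of the set of users as its rows and the users $k$ as its columns; its entry at $(T,k)$ is $*$ if $k\in T$ and the symbol $T\cup\{k\}$ otherwise. The scheme built from it is the following. Each file is split into $\binom Kt$ subfiles $W_n^T$, and each subfile into $B-1$ packets $W_{n,1}^T,\dots,W_{n,B-1}^T$ of $\ell\ge1$ bits; put $W_{n,0}^T=0$. User $k$ caches $W_n^T$ for all $n$ and all $T\ni k$. User $k$ draws a uniform vector $V^k\in\{0,\dots,B-1\}^{N-1}$, independently of the other users, and its query to server $b\in\{0,\dots,B-1\}$ is the vector $Q_b^k\in\{0,\dots,B-1\}^N$ obtained from $V^k$ by inserting the entry $b-\sum_i V_i^k \bmod B$ at position $d_k$. For each $(t+1)$-subset $s$ of users, server $b$ broadcasts $\sum_{k\in s}\sum_n W^{s\setminus\{k\}}_{n,Q^k_{b,n}}$, unless $Q_b^k=0$ for all $k\in s$, when it sends nothing for $s$. Let $R(M)$ be the minimum of the rate of this scheme and of the rate $N-M$ (which is achieved when all users cache the same fraction $M/N$ of each file and the rest of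 all files is transmitted). Theorem. (1) The rate is $$R(M)=\min\Big\{N-M,\ \frac{K-t}{t+1}\sum_{i=0}^{(t+1)(N-1)}B^{-i}\Big\}.$$ (2) $R(M)\le 8\,R^*_{cc}(M)$; and if $N\ge K$, then $R(M)\le 2\,R^*_{ucc}(M)$. (3) Consequently the scheme is order optimal: $R^*(M)\le R(M)\le 8\,R^*(M)$; moreover $R^*_u(M)\le R(M)$, and $R(M)\le 2\,R^*_u(M)$ if $N\ge K$. -/

import Mathlib

noncomputable section

namespace MuPIR

/-! ## Files, entropy, uncoded placement -/

/-- A library of `N` files. Each file is a string of bits whose positions are indexed by the finite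
type `ι`, so that the file length is `L = Fintype.card ι`. The files are independent and uniform:
the library is uniformly distributed on this finite type. -/
abbrev Files (N : ℕ) (ι : Type) : Type := Fin N → ι → ZMod 2

/-- Shannon entropy in bits of `f X`, where `X` is uniformly distributed on the finite type `α`. -/
def entropyBits {α β : Type} [Fintype β] (f : α → β) : ℝ :=
  ∑ z : β, Real.negMulLog ((Nat.card {a : α // f a = z} : ℝ) / (Nat.card α : ℝ)) / Real.log 2

/-- A cache content `z`, as a function of the files, is uncoded if it amounts to a set `A` of raw
bits of the files: it determines these bits and is determined by them. -/
def IsUncoded {N : ℕ} {ι β : Type} (z : Files N ι → β) : Prop :=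
  ∃ A : Finset (Fin N × ι), ∀ w w' : Files N ι,
    z w = z w' ↔ ∀ p ∈ A, w p.1 p.2 = w' p.1 p.2

/-! ## Coded caching (one server, no privacy) -/

/-- Placement and delivery of a coded caching scheme with `N` files and `K` users. -/
structure CCScheme (N K : ℕ) (ι : Type) where
  /-- number of bits of a cache -/
  memLen : ℕ
  /-- number of bits of the broadcast (for the worst demand vector) -/
  txLen : ℕ
  /-- placement, made without knowledge of the demands -/
  cache : Fin K → Files N ι → (Fin memLen → ZMod 2)
  /-- the broadcast, a function of the demand vector and of the files -/
  transmit : (Fin K → Fin N) → Files N ι → (Fin txLen → ZMod 2)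

/-- For every demand vector `d`, every user `k` can recover file `d k` without error from the
broadcast and its own cache: the file is determined by them. -/
def CCScheme.Correct {N K : ℕ} {ι : Type} (C : CCScheme N K ι) : Prop :=
  ∀ (d : Fin K → Fin N) (k : Fin K) (w w' : Files N ι),
    C.transmit d w = C.transmit d w' → C.cache k w = C.cache k w' → w (d k) = w' (d k)

/-- The rate `R` is achievable for coded caching with cache size `M` (both in units of files). -/
def CCAchievable (N K : ℕ) (M R : ℝ) : Prop :=
  ∃ (ι : Type) (_ : Fintype ι) (_ : Nonempty ι) (C : CCScheme N K ι),
    C.Correct ∧ (C.memLen : ℝ) ≤ M * Fintype.card ι ∧ (C.txLen : ℝ) ≤ R * Fintype.card ι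

/-- The same with uncoded placement. -/
def UCCAchievable (N K : ℕ) (M R : ℝ) : Prop :=
  ∃ (ι : Type) (_ : Fintype ι) (_ : Nonempty ι) (C : CCScheme N K ι),
    C.Correct ∧ (∀ k, IsUncoded (C.cache k)) ∧
      (C.memLen : ℝ) ≤ M * Fintype.card ι ∧ (C.txLen : ℝ) ≤ R * Fintype.card ι

/-- The optimal coded caching rate `R*_cc(M)`. -/
def RccStar (N K : ℕ) (M : ℝ) : ℝ := sInf {R : ℝ | CCAchievable N K M R}

/-- The optimal coded caching rate under uncoded placement, `R*_ucc(M)`. -/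
def RuccStar (N K : ℕ) (M : ℝ) : ℝ := sInf {R : ℝ | UCCAchievable N K M R}

/-! ## Cache-aided multi-user private information retrieval -/

/-- Placement, queries and answers of a cache-aided multi-user PIR scheme with `B` servers, `N`
files and `K` users. -/
structure Scheme (B N K : ℕ) (ι : Type) where
  /-- the alphabet of the cache content of each user -/
  Mem : Fin K → Type
  memFintype : ∀ k, Fintype (Mem k)
  /-- the query alphabet -/
  Query : Type
  queryFintype : Fintype Query
  /-- placement, made without knowledge of the demands -/
  cache : (k : Fin K) → Files N ι → Mem k
  /-- for each demand vector, the joint law of the queries to the servers; the users draw the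
  queries independently of the files -/
  queryLaw : (Fin K → Fin N) → PMF (Fin B → Query)
  /-- the number of bits that server `b` broadcasts when it receives a given query -/
  ansLen : Fin B → Query → ℕ
  /-- the answer of server `b`, a function of the query it receives and of the files -/
  answer : (b : Fin B) → (q : Query) → Files N ι → (Fin (ansLen b q) → ZMod 2)

attribute [instance] Scheme.memFintype Scheme.queryFintype

namespace Scheme

variable {B N K : ℕ} {ι : Type}

/-- No server learns anything about the demand vector: the law of the query to any one server does
not depend on the demand vector. (The files are independent of queries and demands.) -/
def Private (C : Scheme B N K ι) : Prop :=
  ∀ (b : Fin B) (d d' : Fin K → Fin N),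
    (C.queryLaw d).map (fun q => q b) = (C.queryLaw d').map (fun q => q b)

/-- For every demand vector `d` and all queries that may occur, every user `k` can recover file
`d k` without error from the queries, all the answers and its own cache. -/
def Correct (C : Scheme B N K ι) : Prop :=
  ∀ (d : Fin K → Fin N), ∀ q ∈ (C.queryLaw d).support, ∀ (k : Fin K) (w w' : Files N ι),
    (∀ b, C.answer b (q b) w = C.answer b (q b) w') → C.cache k w = C.cache k w' →
      w (d k) = w' (d k)

/-- The expected total number of broadcast bits, divided by the file length, for demand `d`. -/
def rateAt [Fintype ι] (C : Scheme B N K ι) (d : Fin K → Fin N) : ℝ :=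
  (∑ q : Fin B → C.Query, (C.queryLaw d q).toReal * ∑ b, (C.ansLen b (q b) : ℝ)) /
    Fintype.card ι

/-- The rate of a scheme. (For a private scheme `rateAt` does not depend on the demand vector.) -/
def rate [Fintype ι] (C : Scheme B N K ι) : ℝ := ⨆ d : Fin K → Fin N, C.rateAt d

end Scheme

/-- The rate `R` is achievable for cache-aided multi-user PIR with cache size `M` (in files). -/
def Achievable (B N K : ℕ) (M R : ℝ) : Prop :=
  ∃ (ι : Type) (_ : Fintype ι) (_ : Nonempty ι) (C : Scheme B N K ι),
    C.Private ∧ C.Correct ∧ (∀ k, entropyBits (C.cache k) ≤ M * Fintype.card ι) ∧ C.rate ≤ R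

/-- The same with uncoded placement. -/
def UAchievable (B N K : ℕ) (M R : ℝ) : Prop :=
  ∃ (ι : Type) (_ : Fintype ι) (_ : Nonempty ι) (C : Scheme B N K ι),
    C.Private ∧ C.Correct ∧ (∀ k, IsUncoded (C.cache k)) ∧
      (∀ k, entropyBits (C.cache k) ≤ M * Fintype.card ι) ∧ C.rate ≤ R

/-- The optimal rate `R*(M)` of cache-aided multi-user PIR. -/
def RStar (B N K : ℕ) (M : ℝ) : ℝ := sInf {R : ℝ | Achievable B N K M R}

/-- The optimal rate of cache-aided multi-user PIR under uncoded placement. -/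
def RuStar (B N K : ℕ) (M : ℝ) : ℝ := sInf {R : ℝ | UAchievable B N K M R}

/-! ## Placement delivery arrays -/

/-- A placement delivery array with rows `ρ`, columns `κ` and integers `σ`; `none` is the
symbol `*`. -/
structure PDA (ρ κ σ : Type) (Z : ℕ) where
  entry : ρ → κ → Option σ
  /-- `*` appears `Z` times in each column -/
  star_count : ∀ k, Nat.card {f : ρ // entry f k = none} = Z
  /-- each integer occurs -/
  occurs : ∀ s, ∃ f k, entry f k = some s
  /-- two distinct entries are the same integer only if they lie in distinct rows and columns and
  the other two corners are `*` -/
  square : ∀ f₁ k₁ f₂ k₂ s, (f₁, k₁) ≠ (f₂, k₂) → entry f₁ k₁ = some s → entry f₂ k₂ = some s →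
    f₁ ≠ f₂ ∧ k₁ ≠ k₂ ∧ entry f₁ k₂ = none ∧ entry f₂ k₁ = none

/-- The number of `t`-subsets of a `K`-set that contain a given element. -/
def manStars (K t : ℕ) : ℕ := if t = 0 then 0 else (K - 1).choose (t - 1)

theorem card_subsets_mem (K t : ℕ) (k : Fin K) :
    Nat.card {T : {T : Finset (Fin K) // T.card = t} // k ∈ T.1} = manStars K t := by
  classical
  cases t with
  | zero =>
    have : IsEmpty {T : {T : Finset (Fin K) // T.card = 0} // k ∈ T.1} := by
      refine ⟨fun T => ?_⟩
      have h := T.2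
      rw [Finset.card_eq_zero.1 T.1.2] at h
      simp at h
    simp [manStars]
  | succ t =>
    have e : {T : {T : Finset (Fin K) // T.card = t + 1} // k ∈ T.1} ≃
        {T : Finset (Fin K) // T ∈ (Finset.univ.erase k).powersetCard t} :=
      { toFun := fun T => ⟨T.1.1.erase k, by
          rw [Finset.mem_powersetCard]
          refine ⟨Finset.erase_subset_erase k (Finset.subset_univ _), ?_⟩
          rw [Finset.card_erase_of_mem T.2, T.1.2]; rfl⟩
        invFun := fun T => ⟨⟨insert k T.1, by
          have h := Finset.mem_powersetCard.1 T.2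
          rw [Finset.card_insert_of_notMem (fun hk => by simpa using h.1 hk), h.2]⟩, by simp⟩
        left_inv := fun T => by
          apply Subtype.ext; apply Subtype.ext
          exact Finset.insert_erase T.2
        right_inv := fun T => by
          apply Subtype.ext
          have h := Finset.mem_powersetCard.1 T.2
          exact Finset.erase_insert (fun hk => by simpa using h.1 hk) }
    rw [Nat.card_congr e, Nat.card_eq_fintype_card, Fintype.card_coe, Finset.card_powersetCard,
      Finset.card_erase_of_mem (Finset.mem_univ k)]
    simp [manStars]

/-- The PDA of the Maddah-Ali–Niesen scheme: rows are the `t`-subsets of the set of users, integers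
are labelled by the `(t+1)`-subsets; the entry in row `T` and column `k` is `*` if `k ∈ T`, and
the integer labelled `T ∪ {k}` otherwise. -/
def manPDA (K t : ℕ) : PDA {T : Finset (Fin K) // T.card = t} (Fin K)
    {T : Finset (Fin K) // T.card = t + 1} (manStars K t) where
  entry T k := if h : k ∈ T.1 then none
    else some ⟨insert k T.1, by rw [Finset.card_insert_of_notMem h, T.2]⟩
  star_count k := by
    rw [← card_subsets_mem K t k]
    refine Nat.card_congr (Equiv.subtypeEquivRight fun T => ?_)
    by_cases h : k ∈ T.1 <;> simp [h]
  occurs s := by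
    have hne : s.1.Nonempty := Finset.card_pos.1 (by rw [s.2]; omega)
    obtain ⟨k, hk⟩ := hne
    refine ⟨⟨s.1.erase k, by rw [Finset.card_erase_of_mem hk, s.2]; rfl⟩, k, ?_⟩
    simp [Finset.insert_erase hk]
  square f₁ k₁ f₂ k₂ s hne h₁ h₂ := by
    by_cases m₁ : k₁ ∈ f₁.1
    · simp [m₁] at h₁
    by_cases m₂ : k₂ ∈ f₂.1
    · simp [m₂] at h₂
    simp only [m₁, m₂, dite_false, Option.some.injEq] at h₁ h₂
    have e : insert k₁ f₁.1 = insert k₂ f₂.1 := congrArg Subtype.val (h₁.trans h₂.symm)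
    have hk : k₁ ≠ k₂ := by
      rintro rfl
      apply hne
      have : f₁.1 = f₂.1 := by
        rw [← Finset.erase_insert m₁, e, Finset.erase_insert m₂]
      rw [Subtype.ext this]
    have a : k₂ ∈ f₁.1 := by
      have : k₂ ∈ insert k₁ f₁.1 := by rw [e]; simp
      exact (Finset.mem_insert.1 this).resolve_left (Ne.symm hk)
    have b : k₁ ∈ f₂.1 := by
      have : k₁ ∈ insert k₂ f₂.1 := by rw [← e]; simp
      exact (Finset.mem_insert.1 this).resolve_left hk
    refine ⟨?_, hk, by simp [a], by simp [b]⟩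
    rintro rfl
    exact m₂ a

/-! ## The scheme built from a PDA -/

section PDAScheme

variable {K Z : ℕ} {ρ σ : Type}

/-- The bit positions of a file for the PDA scheme: a file is split into subfiles (indexed by the
rows of the PDA), each subfile into `B - 1` packets (indexed by `1, …, B - 1`), and each packet
has `l` bits. -/
abbrev Pos (B : ℕ) [NeZero B] (ρ : Type) (l : ℕ) : Type := ρ × {c : Fin B // c ≠ 0} × Fin l

/-- Bit `j` of packet `c` of subfile `f` of file `n`; packet `0` is the zero string. -/
def packet {B N : ℕ} [NeZero B] {l : ℕ} (w : Files N (Pos B ρ l)) (n : Fin N) (f : ρ) (c : Fin B)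
    (j : Fin l) : ZMod 2 :=
  if h : c = 0 then 0 else w n (f, ⟨c, h⟩, j)

/-- The query vectors. User `k` has drawn the vector `V k` of length `N - 1`; its query to server
`b` is `V k` with the entry `b - ∑ V k` (modulo `B`) inserted at position `d k`. The query to
server `b` consists of the vectors of all the users. -/
def pdaQuery {B N : ℕ} [NeZero B] (d : Fin K → Fin N) (V : Fin K → Fin (N - 1) → Fin B)
    (b : Fin B) : Fin K → Fin N → Fin B :=
  fun k n =>
    if h : n.1 < (d k).1 then V k ⟨n.1, by have := (d k).2; omega⟩
    else if h' : n = d k then b - ∑ i, V k i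
    else V k ⟨n.1 - 1, by
      have h₁ : n.1 ≠ (d k).1 := fun e => h' (Fin.ext e)
      have := n.2
      omega⟩

/-- The symbols for which a server that receives the query `q` broadcasts: those `s` for which the
query vector of at least one user whose column contains `s` is nonzero. (For the remaining `s` the
transmission would be the zero string, whatever the files are.) -/
abbrev Active {B N : ℕ} [NeZero B] (P : PDA ρ (Fin K) σ Z) (q : Fin K → Fin N → Fin B) : Type :=
  {s : σ // ∃ k, (∃ f, P.entry f k = some s) ∧ ∃ n, q k n ≠ 0}

open Classical in
/-- Bit `j` of the transmission for the integer `s` in response to the query `q`. -/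
def pdaTransmission {B N : ℕ} [NeZero B] {l : ℕ} [Fintype ρ] (P : PDA ρ (Fin K) σ Z)
    (q : Fin K → Fin N → Fin B) (s : σ) (w : Files N (Pos B ρ l)) (j : Fin l) : ZMod 2 :=
  ∑ f : ρ, ∑ k : Fin K, if P.entry f k = some s then ∑ n : Fin N, packet w n f (q k n) j else 0

open Classical in
/-- The multi-user PIR scheme of a PDA. User `k` caches subfile `f` of every file if the entry in
row `f` and column `k` is `*`; the vectors `V k` are independent and uniform; a server broadcasts
the transmissions of all active symbols. -/
def pdaScheme (B N : ℕ) [NeZero B] [Fintype ρ] [Fintype σ] (P : PDA ρ (Fin K) σ Z) (l : ℕ) :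
    Scheme B N K (Pos B ρ l) where
  Mem k := Fin N × {f : ρ // P.entry f k = none} × {c : Fin B // c ≠ 0} × Fin l → ZMod 2
  memFintype _ := inferInstance
  Query := Fin K → Fin N → Fin B
  queryFintype := inferInstance
  cache _ w := fun p => w p.1 (p.2.1.1, p.2.2.1, p.2.2.2)
  queryLaw d := (PMF.uniformOfFintype (Fin K → Fin (N - 1) → Fin B)).map (pdaQuery d)
  ansLen _ q := Fintype.card (Active P q × Fin l)
  answer _ q w := fun i =>
    let x := (Fintype.equivFin (Active P q × Fin l)).symm i
    pdaTransmission P q x.1.1 w x.2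

end PDAScheme

/-- The scheme of the Maddah-Ali–Niesen PDA with parameter `t`, with packets of `l` bits. -/
def manScheme (B N K t : ℕ) [NeZero B] (l : ℕ) :
    Scheme B N K (Pos B {T : Finset (Fin K) // T.card = t} l) :=
  pdaScheme B N (manPDA K t) l

/-- The rate obtained from the Maddah-Ali–Niesen PDA at cache size `M = t N / K`: the rate of the
PDA scheme, or the rate `N - M` of the direct transmission of the uncached part of all files
(every user caching the same fraction `M / N` of each file), whichever is smaller. -/
def manRate (B N K t : ℕ) [NeZero B] (l : ℕ) : ℝ :=
  min ((N : ℝ) - (t : ℝ) * N / K) (manScheme B N K t l).rate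

end MuPIR

end

/-! The closed form is a count. Server `b` stays silent on a symbol `s` only if the queries of all
`t + 1` users in `s` vanish. The entries of a query to server `b` add up to `b`, so this requires `b
= 0` and `V k = 0` for every `k ∈ s`, an event of probability `B ^ (-(t + 1) * (N - 1))`. The
expected number of transmissions per symbol is `B` minus this probability; dividing by `B - 1` gives
the geometric sum (`manScheme_rate`). That sum is at most `2`, so the rate is at most `2 * (K - t) /
(t + 1)` (`manRate_le`).

The lower bounds ignore privacy. A private scheme of expected length `R * L` has, for each demand
vector, some query realization with at most that many bits in total; fixing it leaves an ordinary
broadcast. Both models thus reduce to `Deliverable`, and each converse is proved once for that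
notion.

For uncoded placement and `K ≤ N` (`uncoded_converse`), serve the users in some order. The requested
bits cached by nobody up to their requester can be chosen freely and are all decoded, so they fit
into the broadcast. Averaging over orders and cyclically shifted demands, a bit cached by `s` users
contributes `(K - s) / (s + 1)`; convexity in `s` gives `(K - t) / (t + 1) ≤ R`.

For arbitrary caches (`coded_converse`), serve users one at a time, each requesting a file about
which the caches so far reveal little. The broadcast pays for every such file up to the leaked part.
In closed form this gives `(N - M) / (2 * (M + 1)) ≤ R`; comparison with `N - M` for small `M` and
with `2 * (K - t) / (t + 1)` for large `M` yields the factor `8`. -/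

namespace MuPIR

/-! ## Entropy of functions of a uniform variable -/

section Entropy

open Real

variable {Ω : Type} [Fintype Ω] {α β γ : Type}

open Classical in
/-- The fibre of `f` through `ω`. -/
noncomputable def fibre (f : Ω → β) (ω : Ω) : Finset Ω := Finset.univ.filter fun x => f x = f ω

theorem mem_fibre {f : Ω → β} {ω x : Ω} : x ∈ fibre f ω ↔ f x = f ω := by simp [fibre]

theorem self_mem_fibre (f : Ω → β) (ω : Ω) : ω ∈ fibre f ω := mem_fibre.2 rfl

theorem fibre_card_pos (f : Ω → β) (ω : Ω) : (0 : ℝ) < (fibre f ω).card :=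
  Nat.cast_pos.2 (Finset.card_pos.2 ⟨ω, self_mem_fibre f ω⟩)

theorem fibre_congr {f : Ω → β} {ω x : Ω} (h : f x = f ω) : fibre f x = fibre f ω := by
  ext y; rw [mem_fibre, mem_fibre, h]

/-- Shannon entropy, in nats, of `f X` for `X` uniform on `Ω`. -/
noncomputable def unifEntropy (f : Ω → β) : ℝ :=
  (∑ ω, (log (Fintype.card Ω) - log (fibre f ω).card)) / Fintype.card Ω

/-- Averaging over points instead of values lets the later proofs work with functions into arbitrary
types. Values that are not attained contribute `negMulLog 0 = 0`. -/
theorem entropyBits_eq [Nonempty Ω] [Fintype β] (f : Ω → β) :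
    entropyBits f = unifEntropy f / log 2 := by
  classical
  have hΩ : (0 : ℝ) < Fintype.card Ω := Nat.cast_pos.2 Fintype.card_pos
  rw [entropyBits, unifEntropy, ← Finset.sum_div]
  congr 1
  rw [Finset.sum_div, ← Finset.sum_fiberwise Finset.univ f]
  refine Finset.sum_congr rfl fun z _ => ?_
  set S : Finset Ω := Finset.univ.filter fun i => f i = z with hS
  have hc : Nat.card {a : Ω // f a = z} = S.card := by
    rw [Nat.card_eq_fintype_card, Fintype.card_subtype]
  have hsum : ∑ x ∈ S, (log (Fintype.card Ω) - log (fibre f x).card) / (Fintype.card Ω : ℝ) =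
      S.card * ((log (Fintype.card Ω) - log S.card) / (Fintype.card Ω : ℝ)) := by
    rw [← nsmul_eq_mul, ← Finset.sum_const]
    refine Finset.sum_congr rfl fun x hx => ?_
    have : fibre f x = S := by
      ext y; rw [mem_fibre, hS]; simp [(Finset.mem_filter.1 hx).2]
    rw [this]
  rw [hsum, hc, Nat.card_eq_fintype_card, negMulLog]
  rcases Nat.eq_zero_or_pos S.card with h0 | h0
  · simp [h0]
  · rw [log_div (Nat.cast_pos.2 h0).ne' hΩ.ne']
    ring

/-- A function has at most the entropy of any function that determines it. -/
theorem unifEntropy_mono {f : Ω → α} {g : Ω → β} (h : ∀ x y, g x = g y → f x = f y) :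
    unifEntropy f ≤ unifEntropy g := by
  refine div_le_div_of_nonneg_right (Finset.sum_le_sum fun ω _ => ?_) (Nat.cast_nonneg _)
  refine sub_le_sub_left (log_le_log (fibre_card_pos g ω) (Nat.cast_le.2 ?_)) _
  exact Finset.card_le_card fun x hx => mem_fibre.2 (h _ _ (mem_fibre.1 hx))

theorem unifEntropy_nonneg (f : Ω → β) : 0 ≤ unifEntropy f := by
  refine div_nonneg (Finset.sum_nonneg fun ω _ => sub_nonneg.2 ?_) (Nat.cast_nonneg _)
  exact log_le_log (fibre_card_pos f ω) (Nat.cast_le.2 (Finset.card_le_univ _))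

theorem unifEntropy_of_injective [Nonempty Ω] {f : Ω → β} (hf : Function.Injective f) :
    unifEntropy f = log (Fintype.card Ω) := by
  have : ∀ ω, fibre f ω = {ω} := fun ω => by ext y; simp [mem_fibre, hf.eq_iff]
  have hΩ : (Fintype.card Ω : ℝ) ≠ 0 := Nat.cast_ne_zero.2 Fintype.card_ne_zero
  simp only [unifEntropy, this, Finset.card_singleton, Nat.cast_one, log_one, sub_zero,
    Finset.sum_const, Finset.card_univ, nsmul_eq_mul]
  field_simp

/-- Every nonempty fibre contributes exactly `1`, so the sum is the size of the image. -/
theorem sum_inv_card_fibre_le [Fintype β] (f : Ω → β) :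
    ∑ ω, ((fibre f ω).card : ℝ)⁻¹ ≤ Fintype.card β := by
  classical
  rw [← Finset.sum_fiberwise Finset.univ f]
  calc ∑ z : β, ∑ ω ∈ Finset.univ.filter (fun i => f i = z), ((fibre f ω).card : ℝ)⁻¹
      ≤ ∑ _z : β, (1 : ℝ) := Finset.sum_le_sum fun z _ => ?_
    _ = Fintype.card β := by simp
  have h : ∀ ω ∈ Finset.univ.filter (fun i => f i = z), ((fibre f ω).card : ℝ)⁻¹ =
      ((Finset.univ.filter (fun i => f i = z)).card : ℝ)⁻¹ := fun ω hω => by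
    congr 3
    ext y; simp [mem_fibre, (Finset.mem_filter.1 hω).2]
  rw [Finset.sum_congr rfl h, Finset.sum_const, nsmul_eq_mul]
  exact mul_inv_le_one

/-- The entropy is at most the logarithm of the size of the alphabet. -/
theorem unifEntropy_le_log_card [Nonempty Ω] [Fintype β] (f : Ω → β) :
    unifEntropy f ≤ log (Fintype.card β) := by
  have hΩ : (0 : ℝ) < Fintype.card Ω := Nat.cast_pos.2 Fintype.card_pos
  have hβ : (0 : ℝ) < Fintype.card β :=
    Nat.cast_pos.2 (Fintype.card_pos_iff.2 ⟨f (Classical.arbitrary Ω)⟩)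
  rw [unifEntropy, div_le_iff₀ hΩ]
  -- Gibbs' inequality: `log x ≤ x - 1` at `x = |Ω| / (|β| * |fibre|)`, whose sum over `ω` is at
  -- most `|Ω|`.
  have key : ∀ ω, log (Fintype.card Ω) - log (fibre f ω).card ≤ log (Fintype.card β) +
      ((Fintype.card Ω / Fintype.card β : ℝ) * ((fibre f ω).card : ℝ)⁻¹ - 1) := fun ω => by
    have hF := fibre_card_pos f ω
    have h := log_le_sub_one_of_pos
      (show 0 < (Fintype.card Ω / Fintype.card β : ℝ) * ((fibre f ω).card : ℝ)⁻¹ by positivity)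
    rw [log_mul (by positivity) (by positivity), log_div hΩ.ne' hβ.ne', log_inv] at h
    linarith
  refine (Finset.sum_le_sum fun ω _ => key ω).trans ?_
  rw [Finset.sum_add_distrib, Finset.sum_sub_distrib, ← Finset.mul_sum]
  simp only [Finset.sum_const, Finset.card_univ, nsmul_eq_mul, mul_one]
  have h := mul_le_mul_of_nonneg_left (sum_inv_card_fibre_le f)
    (show 0 ≤ (Fintype.card Ω / Fintype.card β : ℝ) by positivity)
  rw [div_mul_cancel₀ _ hβ.ne'] at h
  linarith

/-- Submodularity of entropy. -/
theorem unifEntropy_submodular [Nonempty Ω] (f : Ω → α) (g : Ω → β) (e : Ω → γ) :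
    unifEntropy (fun ω => (f ω, g ω, e ω)) + unifEntropy e ≤
      unifEntropy (fun ω => (f ω, e ω)) + unifEntropy (fun ω => (g ω, e ω)) := by
  classical
  have hΩ : (0 : ℝ) < Fintype.card Ω := Nat.cast_pos.2 Fintype.card_pos
  set fge : Ω → α × β × γ := fun ω => (f ω, g ω, e ω) with hfge
  set fe : Ω → α × γ := fun ω => (f ω, e ω) with hfe
  set ge : Ω → β × γ := fun ω => (g ω, e ω) with hge
  -- This ratio is the exponential of the pointwise entropy deficit, so `log x ≤ x - 1` reduces the
  -- claim to this count. Write the numerator as a number of pairs `(x, y)` and exchange the sums: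
  -- for a given pair the admissible `ω` form one fibre of `fge` or none, which cancels that factor,
  -- and `x`, `y` must share a fibre of `e`.
  have count : ∑ ω, ((fibre fe ω).card * (fibre ge ω).card : ℝ) /
      ((fibre fge ω).card * (fibre e ω).card) ≤ Fintype.card Ω := by
    have expand : ∀ ω, ((fibre fe ω).card * (fibre ge ω).card : ℝ) /
        ((fibre fge ω).card * (fibre e ω).card) =
        ∑ x, ∑ y, if fe x = fe ω ∧ ge y = ge ω then
          (((fibre fge ω).card : ℝ) * (fibre e ω).card)⁻¹ else 0 := fun ω => by
      have : ∀ x, (∑ y, if fe x = fe ω ∧ ge y = ge ω then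
          (((fibre fge ω).card : ℝ) * (fibre e ω).card)⁻¹ else 0) =
          if fe x = fe ω then (fibre ge ω).card *
            (((fibre fge ω).card : ℝ) * (fibre e ω).card)⁻¹ else 0 := fun x => by
        by_cases hx : fe x = fe ω
        · simp only [hx, true_and, if_true]
          rw [← Finset.sum_filter, Finset.sum_const, nsmul_eq_mul]
          congr 3
          ext y; simp [mem_fibre]
        · simp [hx]
      simp only [this]
      rw [← Finset.sum_filter, Finset.sum_const, nsmul_eq_mul, div_eq_mul_inv, mul_assoc]
      congr 3
      ext y; simp [mem_fibre]
    simp only [expand]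
    rw [Finset.sum_comm]
    calc _ = ∑ x, ∑ y, ∑ ω, if fe x = fe ω ∧ ge y = ge ω then
            (((fibre fge ω).card : ℝ) * (fibre e ω).card)⁻¹ else 0 :=
          Finset.sum_congr rfl fun x _ => Finset.sum_comm
      _ ≤ ∑ x, ∑ y, if y ∈ fibre e x then ((fibre e x).card : ℝ)⁻¹ else 0 := by
          refine Finset.sum_le_sum fun x _ => Finset.sum_le_sum fun y _ => ?_
          rw [← Finset.sum_filter]
          set S := Finset.univ.filter fun ω => fe x = fe ω ∧ ge y = ge ω with hS
          rcases S.eq_empty_or_nonempty with h0 | ⟨ω₀, h0⟩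
          · rw [h0, Finset.sum_empty]; split_ifs <;> positivity
          have mem : ∀ ω ∈ S, f x = f ω ∧ e x = e ω ∧ g y = g ω ∧ e y = e ω := fun ω hω => by
            have := (Finset.mem_filter.1 hω).2
            simp only [hfe, hge, Prod.mk.injEq] at this
            tauto
          have hy : y ∈ fibre e x :=
            mem_fibre.2 ((mem ω₀ h0).2.2.2.trans (mem ω₀ h0).2.1.symm)
          rw [if_pos hy]
          have hconst : ∀ ω ∈ S, (((fibre fge ω).card : ℝ) * (fibre e ω).card)⁻¹ =
              ((S.card : ℝ) * (fibre e x).card)⁻¹ := fun ω hω => by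
            have m := mem ω hω
            have h1 : fibre fge ω = S := by
              ext z
              rw [mem_fibre, hS, Finset.mem_filter]
              simp only [hfge, hfe, hge, Prod.mk.injEq, Finset.mem_univ, true_and]
              rw [m.1, m.2.1, m.2.2.1, m.2.2.2]
              tauto
            rw [h1, fibre_congr m.2.1]
          rw [Finset.sum_congr rfl hconst, Finset.sum_const, nsmul_eq_mul, mul_inv, ← mul_assoc]
          exact mul_le_of_le_one_left (by positivity) mul_inv_le_one
      _ = Fintype.card Ω := by
          have : ∀ x, (∑ y, if y ∈ fibre e x then ((fibre e x).card : ℝ)⁻¹ else 0) = 1 :=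
            fun x => by
              rw [← Finset.sum_filter, Finset.sum_const, nsmul_eq_mul, Finset.filter_mem_eq_inter,
                Finset.univ_inter]
              exact mul_inv_cancel₀ (fibre_card_pos e x).ne'
          simp [this]
  rw [unifEntropy, unifEntropy, unifEntropy, unifEntropy, ← add_div, ← add_div,
    ← Finset.sum_add_distrib, ← Finset.sum_add_distrib]
  refine div_le_div_of_nonneg_right ?_ hΩ.le
  have key : ∀ ω, (log (Fintype.card Ω) - log (fibre fge ω).card +
      (log (Fintype.card Ω) - log (fibre e ω).card)) ≤
      (log (Fintype.card Ω) - log (fibre fe ω).card +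
      (log (Fintype.card Ω) - log (fibre ge ω).card)) +
      (((fibre fe ω).card * (fibre ge ω).card : ℝ) /
      ((fibre fge ω).card * (fibre e ω).card) - 1) := fun ω => by
    have h1 := fibre_card_pos fe ω
    have h2 := fibre_card_pos ge ω
    have h3 := fibre_card_pos fge ω
    have h4 := fibre_card_pos e ω
    have h := log_le_sub_one_of_pos (show 0 < ((fibre fe ω).card * (fibre ge ω).card : ℝ) /
      ((fibre fge ω).card * (fibre e ω).card) by positivity)
    rw [log_div (by positivity) (by positivity), log_mul h1.ne' h2.ne', log_mul h3.ne' h4.ne'] at h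
    linarith
  refine (Finset.sum_le_sum fun ω _ => key ω).trans ?_
  rw [Finset.sum_add_distrib]
  have : ∑ ω, (((fibre fe ω).card * (fibre ge ω).card : ℝ) /
      ((fibre fge ω).card * (fibre e ω).card) - 1) ≤ 0 := by
    rw [Finset.sum_sub_distrib]
    simpa using count
  linarith

theorem unifEntropy_pair_le [Nonempty Ω] (f : Ω → α) (g : Ω → β) :
    unifEntropy (fun ω => (f ω, g ω)) ≤ unifEntropy f + unifEntropy g := by
  have h := unifEntropy_submodular f g (fun _ => ())
  have h0 := unifEntropy_nonneg (fun _ : Ω => ())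
  have h1 : unifEntropy (fun ω => (f ω, g ω)) ≤ unifEntropy (fun ω => (f ω, g ω, ())) :=
    unifEntropy_mono fun x y => by simp
  have h2 : unifEntropy (fun ω => (f ω, ())) ≤ unifEntropy f :=
    unifEntropy_mono fun x y => by simp
  have h3 : unifEntropy (fun ω => (g ω, ())) ≤ unifEntropy g :=
    unifEntropy_mono fun x y => by simp
  linarith

end Entropy

/-! ## Delivery, and the converse under uncoded placement -/

/-- For every demand vector there is a function of the files with at most `2 ^ ρ` values that
serves all the users. -/
def Deliverable {N K : ℕ} {ι : Type} {Mem : Fin K → Type} (cache : ∀ k, Files N ι → Mem k)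
    (ρ : ℝ) : Prop :=
  ∀ d : Fin K → Fin N, ∃ (γ : Type) (_ : Fintype γ) (r : ℕ) (X : Files N ι → γ),
    Fintype.card γ ≤ 2 ^ r ∧ (r : ℝ) ≤ ρ ∧
      ∀ k w w', X w = X w' → cache k w = cache k w' → w (d k) = w' (d k)

theorem CCScheme.deliverable {N K : ℕ} {ι : Type} {C : CCScheme N K ι} (hC : C.Correct) {ρ : ℝ}
    (h : (C.txLen : ℝ) ≤ ρ) : Deliverable C.cache ρ := fun d =>
  ⟨_, inferInstance, C.txLen, C.transmit d, by simp, h, fun k w w' => hC d k w w'⟩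

theorem Scheme.rateAt_le_rate {B N K : ℕ} {ι : Type} [Fintype ι] (C : Scheme B N K ι)
    (d : Fin K → Fin N) : C.rateAt d ≤ C.rate :=
  le_ciSup (Set.finite_range C.rateAt).bddAbove d

/-- A mean is at least the smallest value taken with positive probability. Staying inside the
support matters, because correctness is only guaranteed there. -/
theorem Scheme.deliverable {B N K : ℕ} {ι : Type} [Fintype ι] [Nonempty ι] {C : Scheme B N K ι}
    (hC : C.Correct) {R : ℝ} (h : C.rate ≤ R) : Deliverable C.cache (R * Fintype.card ι) := by
  intro d
  have hι : (0 : ℝ) < Fintype.card ι := Nat.cast_pos.2 Fintype.card_pos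
  have hd := (C.rateAt_le_rate d).trans h
  rw [Scheme.rateAt, div_le_iff₀ hι] at hd
  have hsum : ∑ q, (C.queryLaw d q).toReal = 1 := by
    rw [← ENNReal.toReal_sum fun q _ => (C.queryLaw d).apply_ne_top q,
      ← tsum_fintype (L := .unconditional _), PMF.tsum_coe, ENNReal.toReal_one]
  obtain ⟨q, hq, hle⟩ : ∃ q ∈ (C.queryLaw d).support,
      (∑ b, (C.ansLen b (q b) : ℝ)) ≤ R * Fintype.card ι := by
    by_contra! hcon
    refine absurd hd (not_le.2 ?_)
    obtain ⟨q₀, hq₀⟩ := (C.queryLaw d).support_nonempty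
    calc R * Fintype.card ι = ∑ q, (C.queryLaw d q).toReal * (R * Fintype.card ι) := by
          rw [← Finset.sum_mul, hsum, one_mul]
      _ < _ := by
        refine Finset.sum_lt_sum (fun q _ => ?_) ⟨q₀, Finset.mem_univ _, ?_⟩
        · by_cases hq : q ∈ (C.queryLaw d).support
          · exact mul_le_mul_of_nonneg_left (hcon q hq).le ENNReal.toReal_nonneg
          · simp [(PMF.apply_eq_zero_iff _ _).2 hq]
        · exact mul_lt_mul_of_pos_left (hcon q₀ hq₀) (ENNReal.toReal_pos
            ((PMF.mem_support_iff _ _).1 hq₀) ((C.queryLaw d).apply_ne_top _))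
  refine ⟨∀ b, Fin (C.ansLen b (q b)) → ZMod 2, inferInstance, ∑ b, C.ansLen b (q b),
    fun w b => C.answer b (q b) w, ?_, by exact_mod_cast hle, fun k w w' hw hz =>
      hC d q hq k w w' (fun b => congrFun hw b) hz⟩
  simp [Finset.prod_pow_eq_pow_sum]

section Uncoded

variable {N K : ℕ} {ι : Type}

/-- The bits of requested files that no user served up to (and including) the requesting user has
in its cache, when the users are served in the order of increasing `σ`. -/
noncomputable def freshBits [Fintype ι] (A : Fin K → Finset (Fin N × ι)) (σ : Equiv.Perm (Fin K)) :
    Fin N → Fin K → Finset ι := by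
  classical
  exact fun n k => Finset.univ.filter fun p => ∀ j, (n, p) ∈ A j → σ k < σ j

theorem mem_freshBits [Fintype ι] {A : Fin K → Finset (Fin N × ι)} {σ : Equiv.Perm (Fin K)}
    {n : Fin N} {k : Fin K} {p : ι} :
    p ∈ freshBits A σ n k ↔ ∀ j, (n, p) ∈ A j → σ k < σ j := by
  simp [freshBits]

/-- The acyclic-subgraph bound: a broadcast is at least as long as the fresh bits. -/
theorem sum_card_freshBits_le [Fintype ι] {Mem : Fin K → Type} {cache : ∀ k, Files N ι → Mem k}
    {A : Fin K → Finset (Fin N × ι)}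
    (hA : ∀ k w w', (∀ p ∈ A k, w p.1 p.2 = w' p.1 p.2) → cache k w = cache k w')
    {d : Fin K → Fin N} (hd : Function.Injective d) {γ : Type} [Fintype γ] {r : ℕ}
    {X : Files N ι → γ} (hγ : Fintype.card γ ≤ 2 ^ r)
    (hX : ∀ k w w', X w = X w' → cache k w = cache k w' → w (d k) = w' (d k))
    (σ : Equiv.Perm (Fin K)) :
    ∑ k, (freshBits A σ (d k) k).card ≤ r := by
  classical
  let U : Type := Σ k, {p // p ∈ freshBits A σ (d k) k}
  -- Fresh bits are free and every other bit is set to zero. Injectivity of `d` makes the choice of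
  -- `k` unique.
  let ext : (U → ZMod 2) → Files N ι := fun u n p =>
    if h : ∃ k, d k = n ∧ p ∈ freshBits A σ n k then
      u ⟨h.choose, p, by have := h.choose_spec; rw [this.1]; exact this.2⟩ else 0
  have ext_fresh : ∀ u k p (hp : p ∈ freshBits A σ (d k) k), ext u (d k) p = u ⟨k, p, hp⟩ := by
    intro u k p hp
    have h : ∃ k', d k' = d k ∧ p ∈ freshBits A σ (d k) k' := ⟨k, rfl, hp⟩
    have hk : h.choose = k := hd h.choose_spec.1
    have : ∀ (k' : Fin K) (hk' : k' = k) (hp' : p ∈ freshBits A σ (d k') k'),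
        u ⟨k', p, hp'⟩ = u ⟨k, p, hp⟩ := by rintro k' rfl hp'; rfl
    simp only [ext, dif_pos h]
    exact this _ hk _
  have inj : Function.Injective fun u => X (ext u) := by
    intro u u' huu
    -- Decode along the order `σ`: if user `k` caches a bit that is fresh for `j`, then `σ j < σ k`,
    -- so file `d j` is already known; the remaining cached bits are zero in both libraries.
    have key : ∀ (m : ℕ) (k : Fin K), (σ k : ℕ) = m → ext u (d k) = ext u' (d k) := by
      intro m
      induction m using Nat.strong_induction_on with
      | _ m ih =>
        intro k hk
        refine hX k _ _ huu (hA k _ _ fun ⟨n, p⟩ hp => ?_)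
        by_cases h : ∃ j, d j = n ∧ p ∈ freshBits A σ n j
        · obtain ⟨j, rfl, hj⟩ := h
          have hlt := mem_freshBits.1 hj k hp
          exact congrFun (ih (σ j) (by rw [← hk]; exact hlt) j rfl) p
        · simp only [ext, dif_neg h]
    funext ⟨k, p, hp⟩
    rw [← ext_fresh u k p hp, ← ext_fresh u' k p hp, key _ k rfl]
  have hcard := (Fintype.card_le_of_injective _ inj).trans hγ
  rw [Fintype.card_fun, ZMod.card, Fintype.card_sigma] at hcard
  simpa using (Nat.pow_le_pow_iff_right (by norm_num : 1 < 2)).1 hcard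

/-- In a uniformly random order each element of `T` is equally likely to be the first one. -/
theorem card_perm_first_mul (T : Finset (Fin K)) (k : Fin K) (hk : k ∈ T) :
    (Finset.univ.filter fun σ : Equiv.Perm (Fin K) => ∀ j ∈ T, j ≠ k → σ k < σ j).card * T.card =
      K.factorial := by
  classical
  set F : Fin K → Finset (Equiv.Perm (Fin K)) := fun k =>
    Finset.univ.filter fun σ => ∀ j ∈ T, j ≠ k → σ k < σ j with hF
  -- Precomposing with the transposition of `k` and `k'` exchanges the two events, and by uniqueness
  -- of the minimum the events partition all orders.
  have same : ∀ k' ∈ T, (F k').card = (F k).card := by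
    intro k' hk'
    refine Finset.card_bij (fun σ _ => (Equiv.swap k k').trans σ) ?_ ?_ ?_
    · intro σ hσ
      simp only [hF, Finset.mem_filter, Finset.mem_univ, true_and, Equiv.trans_apply,
        Equiv.swap_apply_left] at hσ ⊢
      intro j hj hjk
      by_cases h : j = k'
      · subst h
        rw [Equiv.swap_apply_right]
        exact hσ k hk (Ne.symm hjk)
      · rw [Equiv.swap_apply_of_ne_of_ne hjk h]
        exact hσ j hj h
    · intro σ _ τ _ h
      ext x
      have := congrArg (fun e : Equiv.Perm (Fin K) => e (Equiv.swap k k' x)) h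
      simpa using congrArg Fin.val this
    · intro σ hσ
      refine ⟨(Equiv.swap k k').trans σ, ?_, by ext x; simp⟩
      simp only [hF, Finset.mem_filter, Finset.mem_univ, true_and, Equiv.trans_apply,
        Equiv.swap_apply_right] at hσ ⊢
      intro j hj hjk
      by_cases h : j = k
      · subst h
        rw [Equiv.swap_apply_left]
        exact hσ k' hk' (Ne.symm hjk)
      · rw [Equiv.swap_apply_of_ne_of_ne h hjk]
        exact hσ j hj h
  have union : T.biUnion F = Finset.univ := by
    ext σ
    simp only [Finset.mem_biUnion, Finset.mem_univ, iff_true]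
    obtain ⟨m, hm, hmin⟩ := Finset.exists_min_image T σ ⟨k, hk⟩
    refine ⟨m, hm, ?_⟩
    simp only [hF, Finset.mem_filter, Finset.mem_univ, true_and]
    exact fun j hj hne => lt_of_le_of_ne (hmin j hj) fun h => hne (σ.injective h).symm
  have disj : ∀ x ∈ T, ∀ y ∈ T, x ≠ y → Disjoint (F x) (F y) := by
    intro x hx y hy hxy
    rw [Finset.disjoint_left]
    intro σ h1 h2
    simp only [hF, Finset.mem_filter, Finset.mem_univ, true_and] at h1 h2
    exact lt_asymm (h1 y hy (Ne.symm hxy)) (h2 x hx hxy)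
  have := Finset.card_biUnion disj
  rw [union, Finset.sum_congr rfl same, Finset.sum_const, Finset.card_univ, Fintype.card_perm,
    Fintype.card_fin, smul_eq_mul] at this
  rw [mul_comm]
  exact this.symm

/-- The expected number of elements that precede all elements of `S` in a uniformly random
order. -/
theorem sum_card_perm_before (S : Finset (Fin K)) :
    (∑ k, ((Finset.univ.filter fun σ : Equiv.Perm (Fin K) => ∀ j ∈ S, σ k < σ j).card : ℝ)) =
      K.factorial * (((K : ℝ) - S.card) / (S.card + 1)) := by
  classical
  have h : ∀ k, ((Finset.univ.filter fun σ : Equiv.Perm (Fin K) =>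
      ∀ j ∈ S, σ k < σ j).card : ℝ) = if k ∈ Sᶜ then (K.factorial : ℝ) / (S.card + 1) else 0 := by
    intro k
    by_cases hk : k ∈ S
    · rw [if_neg (by simpa using hk), Nat.cast_eq_zero, Finset.card_eq_zero,
        Finset.filter_eq_empty_iff]
      exact fun σ _ h => lt_irrefl _ (h k hk)
    -- For `k ∉ S`, preceding all of `S` means being first in `insert k S`, which has `S.card + 1`
    -- elements.
    · rw [if_pos (by simpa using hk), eq_div_iff (by positivity)]
      have := card_perm_first_mul (insert k S) k (Finset.mem_insert_self _ _)
      rw [Finset.card_insert_of_notMem hk] at this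
      rw [← this]
      push_cast
      congr 3
      ext σ
      simp only [Finset.mem_filter, Finset.mem_univ, true_and]
      constructor
      · intro h j hj hne
        exact h j ((Finset.mem_insert.1 hj).resolve_left hne)
      · intro h j hj
        exact h j (Finset.mem_insert_of_mem hj) (by rintro rfl; exact hk hj)
  simp only [h]
  rw [← Finset.sum_filter, Finset.sum_const, Finset.filter_mem_eq_inter, Finset.univ_inter,
    Finset.card_compl, Fintype.card_fin, nsmul_eq_mul,
    Nat.cast_sub (by simpa using Finset.card_le_univ S)]
  ring

/-- The converse under uncoded placement, for at least as many files as users. -/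
theorem uncoded_converse [Fintype ι] [Nonempty ι] (hK : 1 ≤ K) (hKN : K ≤ N)
    {Mem : Fin K → Type} {cache : ∀ k, Files N ι → Mem k} {A : Fin K → Finset (Fin N × ι)}
    (hA : ∀ k w w', (∀ p ∈ A k, w p.1 p.2 = w' p.1 p.2) → cache k w = cache k w')
    {t : ℕ} (hcard : ∀ k, ((A k).card : ℝ) ≤ (t : ℝ) * N / K * Fintype.card ι) {R : ℝ}
    (hR : Deliverable cache (R * Fintype.card ι)) :
    ((K : ℝ) - t) / (t + 1) ≤ R := by
  classical
  have hN : NeZero N := ⟨by omega⟩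
  have hKpos : (0 : ℝ) < K := by exact_mod_cast hK
  have hNpos : (0 : ℝ) < N := by exact_mod_cast hK.trans hKN
  have hι : (0 : ℝ) < Fintype.card ι := Nat.cast_pos.2 Fintype.card_pos
  -- Cyclic shifts: each `d c` has distinct demands, and over all `c` every user requests every file
  -- exactly once.
  let d : Fin N → Fin K → Fin N := fun c k => Fin.castLE hKN k + c
  have hd : ∀ c, Function.Injective (d c) := fun c k k' h =>
    Fin.castLE_injective hKN (add_right_cancel h)
  let S : Fin N → ι → Finset (Fin K) := fun n p => Finset.univ.filter fun j => (n, p) ∈ A j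
  have bound : ∀ c σ, ∑ k, ((freshBits A σ (d c k) k).card : ℝ) ≤ R * Fintype.card ι := by
    intro c σ
    obtain ⟨γ, _, r, X, hγ, hr, hX⟩ := hR (d c)
    refine le_trans ?_ hr
    exact_mod_cast sum_card_freshBits_le hA (hd c) hγ hX σ
  have total : ∑ c, ∑ σ : Equiv.Perm (Fin K), ∑ k, ((freshBits A σ (d c k) k).card : ℝ) =
      ∑ n, ∑ p, K.factorial * (((K : ℝ) - (S n p).card) / ((S n p).card + 1)) := by
    have shift : ∀ (k : Fin K) (g : Fin N → ℝ), ∑ c, g (d c k) = ∑ n, g n := fun k g =>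
      Equiv.sum_comp (Equiv.addLeft (Fin.castLE hKN k)) g
    calc _ = ∑ k, ∑ σ : Equiv.Perm (Fin K), ∑ c, ((freshBits A σ (d c k) k).card : ℝ) := by
          rw [Finset.sum_congr rfl fun c _ => Finset.sum_comm, Finset.sum_comm]
          exact Finset.sum_congr rfl fun k _ => Finset.sum_comm
      _ = ∑ k, ∑ σ : Equiv.Perm (Fin K), ∑ n, ((freshBits A σ n k).card : ℝ) := by
          refine Finset.sum_congr rfl fun k _ => Finset.sum_congr rfl fun σ _ => ?_
          exact shift k fun n => ((freshBits A σ n k).card : ℝ)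
      _ = ∑ n, ∑ k, ∑ σ : Equiv.Perm (Fin K), ∑ p,
            if ∀ j ∈ S n p, σ k < σ j then (1 : ℝ) else 0 := by
          rw [Finset.sum_congr rfl fun k _ => Finset.sum_comm, Finset.sum_comm]
          refine Finset.sum_congr rfl fun n _ => Finset.sum_congr rfl fun k _ =>
            Finset.sum_congr rfl fun σ _ => ?_
          rw [Finset.sum_boole]
          congr 2
          ext p
          simp [mem_freshBits, S]
      _ = ∑ n, ∑ p, ∑ k, ∑ σ : Equiv.Perm (Fin K),
            if ∀ j ∈ S n p, σ k < σ j then (1 : ℝ) else 0 := by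
          refine Finset.sum_congr rfl fun n _ => ?_
          rw [Finset.sum_congr rfl fun k _ => Finset.sum_comm, Finset.sum_comm]
      _ = _ := by
          refine Finset.sum_congr rfl fun n _ => Finset.sum_congr rfl fun p _ => ?_
          rw [← sum_card_perm_before]
          refine Finset.sum_congr rfl fun k _ => ?_
          simp
  have upper : ∑ c, ∑ σ : Equiv.Perm (Fin K), ∑ k, ((freshBits A σ (d c k) k).card : ℝ) ≤
      N * (K.factorial * (R * Fintype.card ι)) := by
    refine (Finset.sum_le_sum fun c _ => Finset.sum_le_sum fun σ _ => bound c σ).trans_eq ?_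
    simp [Finset.card_univ, Fintype.card_perm]
  -- Double counting of cached bits: on average a bit lies in at most `t` caches.
  have count : ∑ n, ∑ p, ((S n p).card : ℝ) ≤ t * N * Fintype.card ι := by
    have : ∑ n, ∑ p, ((S n p).card : ℝ) = ∑ k, ((A k).card : ℝ) := by
      have h1 : ∀ n p, ((S n p).card : ℝ) = ∑ k, if (n, p) ∈ A k then 1 else 0 := fun n p => by
        rw [Finset.sum_boole]
      simp only [h1]
      rw [← Fintype.sum_prod_type' fun n p => ∑ k, if (n, p) ∈ A k then (1 : ℝ) else 0,
        Finset.sum_comm]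
      refine Finset.sum_congr rfl fun k _ => ?_
      simp
    rw [this]
    refine (Finset.sum_le_sum fun k _ => hcard k).trans_eq ?_
    simp only [Finset.sum_const, Finset.card_univ, Fintype.card_fin, nsmul_eq_mul]
    field_simp
  -- The tangent at `s = t` to the convex function `(K - s) / (s + 1)`. It is decreasing in `s`, so
  -- the upper bound on the average of `s` suffices.
  have tangent : ∀ s : ℝ, 0 ≤ s → ((K : ℝ) + 1) * (2 / (t + 1) - (s + 1) / (t + 1) ^ 2) - 1 ≤
      ((K : ℝ) - s) / (s + 1) := by
    intro s hs
    have h1 : ((K : ℝ) - s) / (s + 1) = (K + 1) * (1 / (s + 1)) - 1 := by field_simp; ring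
    rw [h1]
    refine sub_le_sub_right (mul_le_mul_of_nonneg_left ?_ (by positivity)) _
    have : 1 / (s + 1) - (2 / ((t : ℝ) + 1) - (s + 1) / (t + 1) ^ 2) =
        (s - t) ^ 2 / ((s + 1) * (t + 1) ^ 2) := by field_simp; ring
    have h2 : 0 ≤ (s - t) ^ 2 / ((s + 1) * ((t : ℝ) + 1) ^ 2) := by positivity
    linarith
  have lower : (N * Fintype.card ι : ℝ) * (((K : ℝ) - t) / (t + 1)) ≤
      ∑ n, ∑ p, ((K : ℝ) - (S n p).card) / ((S n p).card + 1) := by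
    refine le_trans ?_ (Finset.sum_le_sum fun n _ => Finset.sum_le_sum fun p _ =>
      tangent (S n p).card (Nat.cast_nonneg _))
    have : ∀ s : ℝ, ((K : ℝ) + 1) * (2 / (t + 1) - (s + 1) / (t + 1) ^ 2) - 1 =
        (((K : ℝ) + 1) * (2 / (t + 1) - 1 / (t + 1) ^ 2) - 1) - (K + 1) / (t + 1) ^ 2 * s := by
      intro s; ring
    simp only [this, Finset.sum_sub_distrib, ← Finset.mul_sum, Finset.sum_const, Finset.card_univ,
      Fintype.card_fin, nsmul_eq_mul, mul_one]
    have h := mul_le_mul_of_nonneg_left count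
      (show (0 : ℝ) ≤ (K + 1) / (t + 1) ^ 2 by positivity)
    refine le_trans (le_of_eq ?_) (sub_le_sub_left h _)
    field_simp
    ring
  simp only [← Finset.mul_sum] at total
  rw [total] at upper
  have hf : (0 : ℝ) < K.factorial := Nat.cast_pos.2 K.factorial_pos
  have h := (mul_le_mul_of_nonneg_left lower hf.le).trans upper
  have h' : (K.factorial * N * Fintype.card ι : ℝ) * (((K : ℝ) - t) / (t + 1)) ≤
      (K.factorial * N * Fintype.card ι : ℝ) * R := by linarith
  exact le_of_mul_le_mul_left h' (by positivity)

end Uncoded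

/-! ## The converse for arbitrary caches -/

section Coded

open Real

variable {N K : ℕ} {ι : Type}

/-- The files with index in `A`. -/
def restrictFiles (A : Finset (Fin N)) (w : Files N ι) : A → ι → ZMod 2 := fun n => w n

theorem restrictFiles_eq_iff {A : Finset (Fin N)} {w w' : Files N ι} :
    restrictFiles A w = restrictFiles A w' ↔ ∀ n ∈ A, w n = w' n := by
  simp [restrictFiles, funext_iff]

variable {Mem : Fin K → Type}

/-- The contents of the first `i` caches. -/
def firstCaches (cache : ∀ k, Files N ι → Mem k) (i : ℕ) (w : Files N ι) :
    (k : {k : Fin K // k.1 < i}) → Mem k := fun k => cache k w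

theorem firstCaches_eq_iff {cache : ∀ k, Files N ι → Mem k} {i : ℕ} {w w' : Files N ι} :
    firstCaches cache i w = firstCaches cache i w' ↔ ∀ k : Fin K, k.1 < i →
      cache k w = cache k w' := by
  simp [firstCaches, funext_iff]

theorem firstCaches_succ {cache : ∀ k, Files N ι → Mem k} {i : ℕ} (hi : i < K)
    {w w' : Files N ι} : firstCaches cache (i + 1) w = firstCaches cache (i + 1) w' ↔
      cache ⟨i, hi⟩ w = cache ⟨i, hi⟩ w' ∧ firstCaches cache i w = firstCaches cache i w' := by
  simp only [firstCaches_eq_iff]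
  constructor
  · exact fun h => ⟨h _ (Nat.lt_succ_self i), fun k hk => h k (hk.trans (Nat.lt_succ_self i))⟩
  · rintro ⟨h1, h2⟩ k hk
    rcases Nat.lt_succ_iff_lt_or_eq.1 hk with h | h
    · exact h2 k h
    · have : k = ⟨i, hi⟩ := Fin.ext h
      rw [this]; exact h1

variable [Fintype ι] [DecidableEq ι]

theorem unifEntropy_restrictFiles_le (A : Finset (Fin N)) :
    unifEntropy (restrictFiles (ι := ι) A) ≤ A.card * (Fintype.card ι * log 2) := by
  refine (unifEntropy_le_log_card _).trans_eq ?_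
  simp [ZMod.card]

/-- Revealing the remaining files one by one. -/
theorem unifEntropy_union_le {α : Type} (Y : Files N ι → α) (A T : Finset (Fin N)) :
    unifEntropy (fun w => (Y w, restrictFiles (A ∪ T) w)) -
        unifEntropy (fun w => (Y w, restrictFiles A w)) ≤
      ∑ n ∈ T, (unifEntropy (fun w => (Y w, restrictFiles (insert n A) w)) -
        unifEntropy (fun w => (Y w, restrictFiles A w))) := by
  induction T using Finset.induction_on with
  | empty =>
    rw [Finset.sum_empty, sub_nonpos]
    exact unifEntropy_mono fun w w' => by simp [restrictFiles_eq_iff]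
  | insert m T hm ih =>
    rw [Finset.sum_insert hm]
    -- Given `Y` and the files in `A`, learning file `m` adds no more entropy after `T` than before
    -- it.
    have h := unifEntropy_submodular (fun w : Files N ι => w m) (restrictFiles T)
      (fun w => (Y w, restrictFiles A w))
    have h1 : unifEntropy (fun w : Files N ι => (Y w, restrictFiles (A ∪ insert m T) w)) ≤
        unifEntropy (fun w => (w m, restrictFiles T w, Y w, restrictFiles A w)) :=
      unifEntropy_mono fun w w' hw => by
        simp only [Prod.mk.injEq, restrictFiles_eq_iff] at hw ⊢
        refine ⟨hw.2.2.1, fun n hn => ?_⟩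
        rcases Finset.mem_union.1 hn with hn | hn
        · exact hw.2.2.2 n hn
        · rcases Finset.mem_insert.1 hn with rfl | hn
          · exact hw.1
          · exact hw.2.1 n hn
    have h2 : unifEntropy (fun w : Files N ι => (w m, Y w, restrictFiles A w)) ≤
        unifEntropy (fun w => (Y w, restrictFiles (insert m A) w)) :=
      unifEntropy_mono fun w w' hw => by
        simp only [Prod.mk.injEq, restrictFiles_eq_iff] at hw ⊢
        exact ⟨hw.2 m (Finset.mem_insert_self _ _), hw.1,
          fun n hn => hw.2 n (Finset.mem_insert_of_mem hn)⟩
    have h3 : unifEntropy (fun w : Files N ι => (restrictFiles T w, Y w, restrictFiles A w)) ≤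
        unifEntropy (fun w => (Y w, restrictFiles (A ∪ T) w)) :=
      unifEntropy_mono fun w w' hw => by
        simp only [Prod.mk.injEq, restrictFiles_eq_iff] at hw ⊢
        exact ⟨fun n hn => hw.2 n (Finset.mem_union_right _ hn), hw.1,
          fun n hn => hw.2 n (Finset.mem_union_left _ hn)⟩
    linarith

/-- Among the files outside `A` there is one about which `Y` reveals little. -/
theorem exists_file_fresh {α : Type} (Y : Files N ι → α) (A : Finset (Fin N))
    (hA : A.card < N) :
    ∃ n, n ∉ A ∧ Fintype.card ι * log 2 - unifEntropy Y / (N - A.card) ≤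
      unifEntropy (fun w => (Y w, restrictFiles (insert n A) w)) -
        unifEntropy (fun w => (Y w, restrictFiles A w)) := by
  classical
  have hsub : (0 : ℝ) < N - A.card := sub_pos.2 (Nat.cast_lt.2 hA)
  have hcard : ((Aᶜ).card : ℝ) = N - A.card := by
    rw [Finset.card_compl, Fintype.card_fin, Nat.cast_sub hA.le]
  -- Averaging: the whole library has entropy `N * L * log 2` and `Y` with the files of `A` at most
  -- `H(Y) + A.card * L * log 2`, so the increments of the `N - A.card` other files sum to at least
  -- `(N - A.card) * L * log 2 - H(Y)`.
  by_contra! hcon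
  have hne : Aᶜ.Nonempty := Finset.card_pos.1 (by exact_mod_cast hcard ▸ hsub)
  have hsum := Finset.sum_lt_sum_of_nonempty hne fun n hn => hcon n (by simpa using hn)
  have hu := unifEntropy_union_le Y A Aᶜ
  rw [Finset.sum_const, nsmul_eq_mul, hcard, mul_sub, mul_div_cancel₀ _ hsub.ne'] at hsum
  have h1 : unifEntropy (fun w : Files N ι => (Y w, restrictFiles (A ∪ Aᶜ) w)) =
      N * (Fintype.card ι * log 2) := by
    rw [unifEntropy_of_injective]
    · simp [ZMod.card]
    · intro w w' h
      simp only [Prod.mk.injEq, restrictFiles_eq_iff] at h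
      exact funext fun n => h.2 n (by simp)
  have h2 := unifEntropy_pair_le Y (restrictFiles (ι := ι) A)
  have h3 := unifEntropy_restrictFiles_le (ι := ι) A
  linarith

theorem unifEntropy_firstCaches_le {cache : ∀ k, Files N ι → Mem k} {m : ℝ}
    (hm : ∀ k, unifEntropy (cache k) ≤ m) (i : ℕ) (hi : i ≤ K) :
    unifEntropy (firstCaches cache i) ≤ i * m := by
  induction i with
  | zero =>
    refine (unifEntropy_mono (g := fun _ => ()) fun w w' _ => ?_).trans
      ((unifEntropy_le_log_card _).trans_eq (by simp))
    exact firstCaches_eq_iff.2 fun k hk => absurd hk (Nat.not_lt_zero _)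
  | succ i ih =>
    have h1 : unifEntropy (firstCaches cache (i + 1)) ≤
        unifEntropy fun w => (cache ⟨i, hi⟩ w, firstCaches cache i w) :=
      unifEntropy_mono fun w w' h => (firstCaches_succ hi).2 (Prod.mk.inj h)
    have h2 := unifEntropy_pair_le (cache ⟨i, hi⟩) (firstCaches cache i)
    have h3 := hm ⟨i, hi⟩
    have h4 := ih (by omega)
    push_cast
    linarith

variable [Nonempty ι]

/-- The converse bound obtained by serving `s` users, each with a file about which the caches of
the users served so far reveal little. -/
theorem coded_converse (hN : 1 ≤ N) {cache : ∀ k, Files N ι → Mem k} {M R : ℝ}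
    (hM : ∀ k, unifEntropy (cache k) ≤ M * Fintype.card ι * log 2)
    (hR : Deliverable cache (R * Fintype.card ι)) {s : ℕ} (hsN : s ≤ N) (hsK : s ≤ K) :
    ∑ i ∈ Finset.range s, (1 - (i + 1) * M / ((N : ℝ) - i)) ≤ R := by
  classical
  have hι : (0 : ℝ) < Fintype.card ι := Nat.cast_pos.2 Fintype.card_pos
  have hlog : (0 : ℝ) < log 2 := log_pos one_lt_two
  let pick : ℕ → Finset (Fin N) → Fin N → Prop := fun i A n => n ∉ A ∧
    Fintype.card ι * log 2 - unifEntropy (firstCaches cache (i + 1)) / (N - A.card) ≤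
      unifEntropy (fun w => (firstCaches cache (i + 1) w, restrictFiles (insert n A) w)) -
        unifEntropy (fun w => (firstCaches cache (i + 1) w, restrictFiles A w))
  obtain ⟨A, d, hA0, hAs, hAcard⟩ : ∃ (A : ℕ → Finset (Fin N)) (d : ℕ → Fin N), A 0 = ∅ ∧
      (∀ i < s, A (i + 1) = insert (d i) (A i) ∧ pick i (A i) (d i)) ∧
      ∀ i ≤ s, (A i).card = i := by
    -- Greedy choice. The default file is never taken in the first `s` rounds, since then `(A
    -- i).card = i < s ≤ N`.
    let next : ℕ → Finset (Fin N) → Fin N := fun i A =>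
      if h : A.card < N then (exists_file_fresh (firstCaches cache (i + 1)) A h).choose else ⟨0, hN⟩
    let A : ℕ → Finset (Fin N) := fun i => Nat.rec ∅ (fun i A => insert (next i A) A) i
    have hspec : ∀ i A, A.card < N → pick i A (next i A) := fun i A h => by
      simp only [next, dif_pos h]
      exact (exists_file_fresh (firstCaches cache (i + 1)) A h).choose_spec
    have hcard : ∀ i ≤ s, (A i).card = i := by
      intro i
      induction i with
      | zero => intro _; rfl
      | succ i ih =>
        intro hi
        have h := ih (by omega)
        have : A (i + 1) = insert (next i (A i)) (A i) := rfl
        rw [this, Finset.card_insert_of_notMem (hspec i (A i) (by omega)).1, h]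
    exact ⟨A, fun i => next i (A i), rfl, fun i hi =>
      ⟨rfl, hspec i _ (by rw [hcard i hi.le]; omega)⟩, hcard⟩
  obtain ⟨γ, _, r, X, hγ, hr, hX⟩ := hR fun k => d k
  have hXr : unifEntropy X ≤ R * Fintype.card ι * log 2 := by
    have hp : (0 : ℝ) < Fintype.card γ :=
      Nat.cast_pos.2 (Fintype.card_pos_iff.2 ⟨X (Classical.arbitrary _)⟩)
    calc unifEntropy X ≤ log (Fintype.card γ) := unifEntropy_le_log_card X
      _ ≤ log (2 ^ r) := log_le_log hp (by exact_mod_cast hγ)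
      _ = r * log 2 := by rw [log_pow]
      _ ≤ _ := mul_le_mul_of_nonneg_right hr hlog.le
  -- The conditional entropy of the broadcast given the first `i` caches and the files in `A i`. It
  -- starts at most at `H(X)` and stays nonnegative.
  let D : ℕ → ℝ := fun i => unifEntropy (fun w => (X w, firstCaches cache i w, restrictFiles (A i) w))
    - unifEntropy (fun w => (firstCaches cache i w, restrictFiles (A i) w))
  have hD0 : D 0 ≤ unifEntropy X := by
    have h1 : unifEntropy (fun w => (X w, firstCaches cache 0 w, restrictFiles (A 0) w)) ≤
        unifEntropy X := unifEntropy_mono fun w w' h => by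
      simp only [Prod.mk.injEq, restrictFiles_eq_iff, firstCaches_eq_iff]
      exact ⟨h, fun k hk => absurd hk (Nat.not_lt_zero _), fun n hn => by simp [hA0] at hn⟩
    have h2 := unifEntropy_nonneg (fun w => (firstCaches cache 0 w, restrictFiles (A 0) w))
    simp only [D]
    linarith
  have hstep : ∀ i < s, D (i + 1) +
      (1 - (i + 1) * M / ((N : ℝ) - i)) * (Fintype.card ι * log 2) ≤ D i := by
    intro i hi
    have hiK : i < K := by omega
    obtain ⟨hAi, -, hp⟩ := hAs i hi
    rw [hAcard i hi.le, ← hAi] at hp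
    -- Conditioning on one more cache does not increase the entropy of `X`. Then `X` and that cache
    -- determine file `d i`, so revealing the file lowers the entropy of `X` by the file's own
    -- conditional entropy, which `hp` bounds below.
    have hsub := unifEntropy_submodular X (cache ⟨i, hiK⟩)
      (fun w => (firstCaches cache i w, restrictFiles (A i) w))
    have h1 : unifEntropy (fun w => (X w, firstCaches cache (i + 1) w,
        restrictFiles (A (i + 1)) w)) ≤ unifEntropy (fun w => (X w, cache ⟨i, hiK⟩ w,
          firstCaches cache i w, restrictFiles (A i) w)) := unifEntropy_mono fun w w' h => by
      simp only [Prod.mk.injEq, firstCaches_succ hiK] at h ⊢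
      refine ⟨h.1, ⟨h.2.1, h.2.2.1⟩, restrictFiles_eq_iff.2 fun n hn => ?_⟩
      rw [hAi] at hn
      rcases Finset.mem_insert.1 hn with rfl | hn
      · exact hX ⟨i, hiK⟩ w w' h.1 h.2.1
      · exact restrictFiles_eq_iff.1 h.2.2.2 n hn
    have h2 : unifEntropy (fun w => (cache ⟨i, hiK⟩ w, firstCaches cache i w,
        restrictFiles (A i) w)) ≤ unifEntropy (fun w => (firstCaches cache (i + 1) w,
          restrictFiles (A i) w)) := unifEntropy_mono fun w w' h => by
      simp only [Prod.mk.injEq, firstCaches_succ hiK] at h ⊢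
      tauto
    have h3 : unifEntropy (firstCaches cache (i + 1)) / ((N : ℝ) - i) ≤
        (i + 1) * M / ((N : ℝ) - i) * (Fintype.card ι * log 2) := by
      have hpos : (0 : ℝ) < (N : ℝ) - i := sub_pos.2 (Nat.cast_lt.2 (by omega))
      have := unifEntropy_firstCaches_le hM (i + 1) hiK
      push_cast at this
      rw [div_mul_eq_mul_div]
      exact div_le_div_of_nonneg_right (this.trans_eq (by ring)) hpos.le
    simp only [D]
    linarith
  have hDs : 0 ≤ D s := sub_nonneg.2 (unifEntropy_mono fun w w' h => (Prod.mk.inj h).2)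
  have htel : ∀ j ≤ s, D j + (∑ i ∈ Finset.range j, (1 - (i + 1) * M / ((N : ℝ) - i))) *
      (Fintype.card ι * log 2) ≤ D 0 := by
    intro j
    induction j with
    | zero => simp
    | succ j ih =>
      intro hj
      have h1 := ih (by omega)
      have h2 := hstep j (by omega)
      rw [Finset.sum_range_succ, add_mul]
      linarith
  have := htel s le_rfl
  refine le_of_mul_le_mul_right (a := Fintype.card ι * log 2) ?_ (by positivity)
  linarith

/-- The converse in closed form, at any cache size such that enough users are present. -/
theorem coded_converse_closed {M R : ℝ} (hM0 : 0 ≤ M) (hMN : M ≤ N)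
    (hMK : (N : ℝ) + 1 ≤ K * (M + 1)) {cache : ∀ k, Files N ι → Mem k}
    (hM : ∀ k, unifEntropy (cache k) ≤ M * Fintype.card ι * log 2)
    (hR : Deliverable cache (R * Fintype.card ι)) (hN : 1 ≤ N) :
    ((N : ℝ) - M) / (2 * (M + 1)) ≤ R := by
  have hN0 : (0 : ℝ) < N := by exact_mod_cast hN
  have hM1 : (0 : ℝ) < M + 1 := by linarith
  -- The summand of index `i` equals `(M + 1) * (y - (i + 1)) / (N - i)`, so it is worth serving
  -- about `y` users; `hMK` says that `y ≤ K`.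
  set y : ℝ := (N + 1) / (M + 1) with hy
  have hy0 : 0 ≤ y := by positivity
  have hyK : y ≤ K := (div_le_iff₀ hM1).2 hMK
  have hyM : y * (M + 1) = N + 1 := div_mul_cancel₀ _ hM1.ne'
  obtain ⟨s, hs1, hs2, hs3⟩ : ∃ s : ℕ, (s : ℝ) ≤ y ∧ y ≤ s + 1 ∧ s ≤ N := by
    rcases le_or_gt ⌊y⌋₊ N with h | h
    · exact ⟨⌊y⌋₊, Nat.floor_le hy0, (Nat.lt_floor_add_one y).le, h⟩
    · have h1 : (N : ℝ) + 1 ≤ y := le_trans (by exact_mod_cast h) (Nat.floor_le hy0)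
      -- Since `0 ≤ M` forces `y ≤ N + 1`, the floor exceeds `N` only at `y = N + 1`, where `s = N`
      -- still satisfies `s ≤ y ≤ s + 1`.
      exact ⟨N, by linarith, (div_le_self (by positivity) (by linarith)), le_rfl⟩
  have hsK : s ≤ K := by exact_mod_cast hs1.trans hyK
  refine le_trans ?_ (coded_converse hN hM hR hs3 hsK)
  have hterm : ∀ i ∈ Finset.range s, (M + 1) / N * (y - (i + 1)) ≤
      1 - ((i : ℝ) + 1) * M / ((N : ℝ) - i) := by
    intro i hi
    have his : (i : ℝ) + 1 ≤ s := by exact_mod_cast Finset.mem_range.1 hi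
    have hsN' : (s : ℝ) ≤ N := by exact_mod_cast hs3
    have hpos : (0 : ℝ) < N - i := by linarith
    have e : 1 - ((i : ℝ) + 1) * M / ((N : ℝ) - i) = (M + 1) * (y - (i + 1)) / (N - i) := by
      rw [eq_div_iff hpos.ne', sub_mul, div_mul_cancel₀ _ hpos.ne']
      linarith
    rw [e, div_mul_eq_mul_div]
    exact div_le_div_of_nonneg_left (mul_nonneg hM1.le (by linarith)) hpos
      (by linarith [(Nat.cast_nonneg i : (0 : ℝ) ≤ i)])
  refine le_trans ?_ (Finset.sum_le_sum hterm)
  have hsum : ∀ j : ℕ, ∑ i ∈ Finset.range j, (y - ((i : ℝ) + 1)) = j * y - j * (j + 1) / 2 := by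
    intro j
    induction j with
    | zero => simp
    | succ j ih => rw [Finset.sum_range_succ, ih]; push_cast; ring
  rw [← Finset.mul_sum, hsum]
  -- The right side is concave in `s` and equals the left side at both `s = y - 1` and `s = y`.
  have hconv : y * (y - 1) / 2 ≤ s * y - s * (s + 1) / 2 := by nlinarith
  refine le_trans ?_ (mul_le_mul_of_nonneg_left hconv (by positivity))
  have e : (M + 1) / N * (y * (y - 1) / 2) = (N + 1) / N * (((N : ℝ) - M) / (2 * (M + 1))) := by
    rw [hy]; field_simp; ring
  rw [e]
  refine le_mul_of_one_le_left (div_nonneg (by linarith) (by linarith)) ?_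
  rw [le_div_iff₀ hN0]
  linarith

end Coded

/-! ## The scheme of a placement delivery array -/

section PDAScheme

variable {B N K Z l : ℕ} [NeZero B] {ρ σ : Type}

theorem pdaQuery_self (d : Fin K → Fin N) (V : Fin K → Fin (N - 1) → Fin B) (b : Fin B)
    (k : Fin K) : pdaQuery d V b k (d k) = b - ∑ i, V k i := by
  simp [pdaQuery]

theorem pdaQuery_of_ne (d : Fin K → Fin N) (V : Fin K → Fin (N - 1) → Fin B) (b b' : Fin B)
    (k : Fin K) {n : Fin N} (h : n ≠ d k) : pdaQuery d V b k n = pdaQuery d V b' k n := by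
  simp [pdaQuery, h]

theorem pdaQuery_eq_insertNth {N : ℕ} (d : Fin K → Fin (N + 1)) (V : Fin K → Fin N → Fin B)
    (b : Fin B) (k : Fin K) :
    pdaQuery (N := N + 1) d V b k = (d k).insertNth (α := fun _ => Fin B) (b - ∑ i, V k i) (V k) := by
  refine Fin.eq_insertNth_iff.2 ⟨pdaQuery_self (N := N + 1) d V b k, ?_⟩
  funext i
  simp only [Fin.removeNth]
  rcases lt_or_ge i.castSucc (d k) with h | h
  · rw [Fin.succAbove_of_castSucc_lt _ _ h]
    have h' : (i.castSucc : Fin (N + 1)).1 < (d k).1 := h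
    simp only [pdaQuery, dif_pos h']
    rfl
  · rw [Fin.succAbove_of_le_castSucc _ _ h]
    have h1 : ¬ (i.succ : Fin (N + 1)).1 < (d k).1 := by
      have : (d k).1 ≤ i.1 := h
      simp; omega
    have h2 : i.succ ≠ d k := fun e => by
      have : (d k).1 ≤ i.1 := h
      rw [← e] at this; simp at this
    simp only [pdaQuery, dif_neg h1, dif_neg h2]
    rfl

theorem sum_pdaQuery (hN : 1 ≤ N) (d : Fin K → Fin N) (V : Fin K → Fin (N - 1) → Fin B)
    (b : Fin B) (k : Fin K) : ∑ n, pdaQuery d V b k n = b := by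
  obtain ⟨N, rfl⟩ : ∃ m, N = m + 1 := ⟨N - 1, by omega⟩
  rw [pdaQuery_eq_insertNth, Fin.sum_univ_succAbove _ (d k)]
  simp

theorem pdaQuery_injective (hN : 1 ≤ N) (d : Fin K → Fin N) (b : Fin B) :
    Function.Injective fun V => pdaQuery d V b := by
  obtain ⟨N, rfl⟩ : ∃ m, N = m + 1 := ⟨N - 1, by omega⟩
  intro V V' h
  funext k
  have := congrFun h k
  simp only [pdaQuery_eq_insertNth] at this
  exact (Fin.insertNth_inj.1 this).2

/-- With `sum_pdaQuery` and `pdaQuery_injective`, this makes `V ↦ pdaQuery d V b` a bijection onto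
the arrays with all row sums `b`, a set in which `d` does not occur. -/
theorem exists_pdaQuery_eq (hN : 1 ≤ N) (d : Fin K → Fin N) (b : Fin B)
    (q : Fin K → Fin N → Fin B) (hq : ∀ k, ∑ n, q k n = b) : ∃ V, pdaQuery d V b = q := by
  obtain ⟨N, rfl⟩ : ∃ m, N = m + 1 := ⟨N - 1, by omega⟩
  refine ⟨fun k i => q k ((d k).succAbove i), funext fun k => ?_⟩
  rw [pdaQuery_eq_insertNth]
  refine (Fin.eq_insertNth_iff.2 ⟨?_, rfl⟩).symm
  rw [← hq k, Fin.sum_univ_succAbove _ (d k)]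
  simp

/-- The query vectors vanish exactly if the random vector does and the server is the `0`-th. -/
theorem pdaQuery_eq_zero_iff (hN : 1 ≤ N) (d : Fin K → Fin N)
    (V : Fin K → Fin (N - 1) → Fin B) (b : Fin B) (k : Fin K) :
    (∀ n, pdaQuery d V b k n = 0) ↔ b = 0 ∧ V k = 0 := by
  obtain ⟨N, rfl⟩ : ∃ m, N = m + 1 := ⟨N - 1, by omega⟩
  have : (∀ n, pdaQuery (N := N + 1) d V b k n = 0) ↔ pdaQuery (N := N + 1) d V b k = 0 :=
    funext_iff.symm
  rw [this, pdaQuery_eq_insertNth, Fin.insertNth_eq_iff]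
  constructor
  · rintro ⟨h1, h2⟩
    have hV : V k = 0 := h2
    refine ⟨?_, hV⟩
    simpa [hV] using h1
  · rintro ⟨rfl, h⟩
    refine ⟨by simp [h], h⟩

/-- Two demand vectors parametrize the same set of queries, so a permutation `e` of the random
vectors turns one parametrization into the other, and the uniform law is invariant under `e`. -/
theorem pdaScheme_private [Fintype ρ] [Fintype σ] (hN : 1 ≤ N) (P : PDA ρ (Fin K) σ Z) :
    (pdaScheme B N P l).Private := by
  classical
  intro b d d'
  simp only [pdaScheme, PMF.map_comp]
  let e : (Fin K → Fin (N - 1) → Fin B) ≃ (Fin K → Fin (N - 1) → Fin B) :=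
    Equiv.ofBijective (fun V => (exists_pdaQuery_eq hN d' b (pdaQuery d V b)
      (sum_pdaQuery hN d V b)).choose) (Finite.injective_iff_bijective.1 fun V V' h => by
        refine pdaQuery_injective hN d b ?_
        have h1 := (exists_pdaQuery_eq hN d' b (pdaQuery d V b) (sum_pdaQuery hN d V b)).choose_spec
        have h2 := (exists_pdaQuery_eq hN d' b (pdaQuery d V' b)
          (sum_pdaQuery hN d V' b)).choose_spec
        rw [h] at h1
        exact h1.symm.trans h2)
  have he : ∀ V, pdaQuery d' (e V) b = pdaQuery d V b := fun V =>
    (exists_pdaQuery_eq hN d' b (pdaQuery d V b) (sum_pdaQuery hN d V b)).choose_spec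
  have hu : (PMF.uniformOfFintype (Fin K → Fin (N - 1) → Fin B)).map e =
      PMF.uniformOfFintype _ := by
    ext V
    rw [PMF.map_apply, tsum_fintype, Finset.sum_eq_single (e.symm V)]
    · simp [PMF.uniformOfFintype_apply]
    · exact fun V' _ h => if_neg fun h' => h (by simp [h'])
    · simp
  conv_rhs => rw [← hu]
  rw [PMF.map_comp]
  congr 1
  funext V
  exact (he V).symm

/-- Silence loses nothing: for an inactive symbol only zero packets enter the sum. -/
theorem pdaTransmission_eq_of_answer_eq [Fintype ρ] [Fintype σ] {P : PDA ρ (Fin K) σ Z}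
    {b : Fin B} {q : Fin K → Fin N → Fin B} {w w' : Files N (Pos B ρ l)}
    (h : (pdaScheme B N P l).answer b q w = (pdaScheme B N P l).answer b q w') (s : σ)
    (j : Fin l) : pdaTransmission P q s w j = pdaTransmission P q s w' j := by
  classical
  by_cases hs : ∃ k, (∃ f, P.entry f k = some s) ∧ ∃ n, q k n ≠ 0
  · have := congrFun h (Fintype.equivFin (Active P q × Fin l) (⟨s, hs⟩, j))
    simpa [pdaScheme] using this
  · push Not at hs
    have zero : ∀ v : Files N (Pos B ρ l), pdaTransmission P q s v j = 0 := fun v => by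
      refine Finset.sum_eq_zero fun f _ => Finset.sum_eq_zero fun k _ => ?_
      split_ifs with hf
      · exact Finset.sum_eq_zero fun n _ => by simp [packet, hs k ⟨f, hf⟩ n]
      · rfl
    rw [zero, zero]

/-- By the square property every other occurrence of `s` lies in another row, one where user `k` has
a star; those terms are cached and cancel. -/
theorem pdaTransmission_sub [Fintype ρ] {P : PDA ρ (Fin K) σ Z} {q : Fin K → Fin N → Fin B}
    {w w' : Files N (Pos B ρ l)} {s : σ} {f : ρ} {k : Fin K} (hf : P.entry f k = some s)
    (hw : ∀ n f c j, P.entry f k = none → w n (f, c, j) = w' n (f, c, j)) (j : Fin l) :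
    pdaTransmission P q s w j - pdaTransmission P q s w' j =
      ∑ n, (packet w n f (q k n) j - packet w' n f (q k n) j) := by
  classical
  simp only [pdaTransmission, ← Finset.sum_sub_distrib]
  rw [Finset.sum_eq_single f, Finset.sum_eq_single k]
  · simp [hf]
  · intro k' _ hk'
    by_cases h : P.entry f k' = some s
    · exact absurd rfl (P.square f k' f k s (by simp [hk']) h hf).1
    · simp [h]
  · simp
  · intro f' _ hf'
    refine Finset.sum_eq_zero fun k' _ => ?_
    by_cases h : P.entry f' k' = some s
    · have hn := (P.square f' k' f k s (by simp [hf']) h hf).2.2.1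
      have : ∀ n c, packet w n f' c j = packet w' n f' c j := fun n c => by
        unfold packet
        split_ifs
        · rfl
        · exact hw _ _ _ _ hn
      simp [h, this]
    · simp [h]
  · simp

theorem pdaScheme_correct [Fintype ρ] [Fintype σ] (P : PDA ρ (Fin K) σ Z) :
    (pdaScheme B N P l).Correct := by
  classical
  intro d q hq k w w' hans hcache
  obtain ⟨V, -, rfl⟩ := (PMF.mem_support_map_iff _ _ _).1 hq
  have hw : ∀ n f c j, P.entry f k = none → w n (f, c, j) = w' n (f, c, j) := fun n f c j hf =>
    congrFun hcache (n, ⟨f, hf⟩, c, j)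
  funext ⟨f, c, j⟩
  cases hf : P.entry f k with
  | none => exact hw _ _ _ _ hf
  | some s =>
    have key : ∀ b, ∑ n, (packet w n f (pdaQuery d V b k n) j -
        packet w' n f (pdaQuery d V b k n) j) = 0 := fun b => by
      rw [← pdaTransmission_sub hf hw, sub_eq_zero]
      exact pdaTransmission_eq_of_answer_eq (hans b) s j
    -- Two servers suffice for packet `c`: at position `d k` the first receives `0` and the second
    -- `c`, while their other entries agree. Subtracting isolates the packet.
    have h0 := key (∑ i, V k i)
    have hc := key (c.1 + ∑ i, V k i)
    rw [← Finset.add_sum_erase _ _ (Finset.mem_univ (d k)), pdaQuery_self] at h0 hc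
    rw [sub_self] at h0
    rw [add_sub_cancel_right, Finset.sum_congr rfl fun n hn => by
      rw [pdaQuery_of_ne d V _ (∑ i, V k i) k (Finset.ne_of_mem_erase hn)]] at hc
    simp only [packet, dif_pos, sub_self, zero_add] at h0
    simp only [packet] at hc
    rw [h0, add_zero, dif_neg c.2, dif_neg c.2, sub_eq_zero] at hc
    exact hc

theorem isUncoded_of_bits {ι β : Type} [Fintype β] (e : β → Fin N × ι) :
    IsUncoded (fun (w : Files N ι) (p : β) => w (e p).1 (e p).2) := by
  classical
  refine ⟨Finset.univ.image e, fun w w' => ?_⟩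
  simp [funext_iff]

theorem pdaScheme_isUncoded [Fintype ρ] [Fintype σ] (P : PDA ρ (Fin K) σ Z) (k : Fin K) :
    IsUncoded ((pdaScheme B N P l).cache k) :=
  isUncoded_of_bits fun p : Fin N × {f : ρ // P.entry f k = none} × {c : Fin B // c ≠ 0} × Fin l =>
    (p.1, (p.2.1.1, p.2.2.1, p.2.2.2))

end PDAScheme

/-! ## Rate of the scheme -/

section Rate

variable {B N K t l : ℕ} [NeZero B]

theorem sum_map_uniform {α β : Type} [Fintype α] [Nonempty α] [Fintype β] (f : α → β)
    (F : β → ℝ) :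
    ∑ q, ((PMF.uniformOfFintype α).map f q).toReal * F q = (∑ a, F (f a)) / Fintype.card α := by
  classical
  have h : ∀ q, ((PMF.uniformOfFintype α).map f q).toReal =
      ∑ a, if q = f a then (Fintype.card α : ℝ)⁻¹ else 0 := fun q => by
    rw [PMF.map_apply, tsum_fintype, ENNReal.toReal_sum]
    · refine Finset.sum_congr rfl fun a _ => ?_
      split_ifs <;> simp [PMF.uniformOfFintype_apply]
    · intro a _
      split_ifs <;> simp [PMF.uniformOfFintype_apply]
  simp only [h, Finset.sum_mul]
  rw [Finset.sum_comm, Finset.sum_div]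
  refine Finset.sum_congr rfl fun a _ => ?_
  simp [div_eq_inv_mul]

theorem card_vanishing (s : Finset (Fin K)) :
    (Finset.univ.filter fun V : Fin K → Fin (N - 1) → Fin B => ∀ k ∈ s, V k = 0).card *
      B ^ ((N - 1) * s.card) = B ^ ((N - 1) * K) := by
  classical
  have h : (Finset.univ.filter fun V : Fin K → Fin (N - 1) → Fin B => ∀ k ∈ s, V k = 0) =
      Fintype.piFinset fun k => if k ∈ s then {0} else Finset.univ := by
    ext V
    simp only [Finset.mem_filter, Finset.mem_univ, true_and, Fintype.mem_piFinset]
    refine forall_congr' fun k => ?_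
    by_cases hk : k ∈ s <;> simp [hk]
  have hc : ∀ k, (if k ∈ s then ({0} : Finset (Fin (N - 1) → Fin B)) else Finset.univ).card =
      if k ∈ sᶜ then B ^ (N - 1) else 1 := fun k => by
    by_cases hk : k ∈ s <;> simp [hk]
  rw [h, Fintype.card_piFinset, Finset.prod_congr rfl fun k _ => hc k, ← Finset.prod_filter,
    Finset.prod_const, ← pow_mul, ← pow_add, Finset.filter_mem_eq_inter, Finset.univ_inter,
    ← mul_add, Finset.card_compl_add_card, Fintype.card_fin]

theorem manPDA_entry_iff (k : Fin K) (s : {T : Finset (Fin K) // T.card = t + 1}) :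
    (∃ f, (manPDA K t).entry f k = some s) ↔ k ∈ s.1 := by
  constructor
  · rintro ⟨f, hf⟩
    by_cases h : k ∈ f.1
    · simp [manPDA, h] at hf
    · simp only [manPDA, h, dite_false, Option.some.injEq] at hf
      rw [← hf]; simp
  · intro hk
    refine ⟨⟨s.1.erase k, by rw [Finset.card_erase_of_mem hk, s.2]; rfl⟩, ?_⟩
    simp [manPDA, Finset.insert_erase hk]

theorem sum_card_active (hN : 1 ≤ N) (d : Fin K → Fin N) :
    (∑ V : Fin K → Fin (N - 1) → Fin B, ∑ b, (Nat.card (Active (manPDA K t) (pdaQuery d V b)) : ℝ)) =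
      K.choose (t + 1) * (B ^ ((N - 1) * K) * (B - (1 / B) ^ ((t + 1) * (N - 1)))) := by
  classical
  have hB : (B : ℝ) ≠ 0 := Nat.cast_ne_zero.2 (NeZero.ne B)
  have h1 : ∀ (V : Fin K → Fin (N - 1) → Fin B) b,
      (Nat.card (Active (manPDA K t) (pdaQuery d V b)) : ℝ) =
      ∑ s : {T : Finset (Fin K) // T.card = t + 1},
        (1 - if b = 0 then if ∀ k ∈ s.1, V k = 0 then 1 else 0 else 0) := by
    intro V b
    rw [Nat.card_eq_fintype_card, Fintype.card_subtype, Finset.card_filter, Nat.cast_sum]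
    refine Finset.sum_congr rfl fun s _ => ?_
    have : (∃ k, (∃ f, (manPDA K t).entry f k = some s) ∧ ∃ n, pdaQuery d V b k n ≠ 0) ↔
        ¬ (b = 0 ∧ ∀ k ∈ s.1, V k = 0) := by
      have hne : s.1.Nonempty := Finset.card_pos.1 (by rw [s.2]; omega)
      simp only [manPDA_entry_iff, ← not_forall, pdaQuery_eq_zero_iff hN]
      constructor
      · rintro ⟨k, hk, h⟩ ⟨hb, hV⟩
        exact h ⟨hb, hV k hk⟩
      · intro h
        by_contra! hcon
        obtain ⟨k, hk⟩ := hne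
        exact h ⟨(hcon k hk).1, fun k hk => (hcon k hk).2⟩
    rw [if_congr this rfl rfl]
    by_cases h : b = 0 ∧ ∀ k ∈ s.1, V k = 0
    · rw [if_neg (not_not.2 h), if_pos h.1, if_pos h.2]
      simp
    · rw [if_pos h, ← ite_and, if_neg h]
      simp
  have h2 : ∀ V : Fin K → Fin (N - 1) → Fin B,
      (∑ b, (Nat.card (Active (manPDA K t) (pdaQuery d V b)) : ℝ)) =
      ∑ s : {T : Finset (Fin K) // T.card = t + 1}, ((B : ℝ) - if ∀ k ∈ s.1, V k = 0 then 1 else 0) := by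
    intro V
    simp only [h1]
    rw [Finset.sum_comm]
    refine Finset.sum_congr rfl fun s _ => ?_
    rw [Finset.sum_sub_distrib]
    simp
  simp only [h2]
  rw [Finset.sum_comm]
  have h3 : ∀ s : {T : Finset (Fin K) // T.card = t + 1},
      (∑ V : Fin K → Fin (N - 1) → Fin B, ((B : ℝ) - if ∀ k ∈ s.1, V k = 0 then 1 else 0)) =
      B ^ ((N - 1) * K) * (B - (1 / B) ^ ((t + 1) * (N - 1))) := by
    intro s
    have h := card_vanishing (B := B) (N := N) s.1
    rw [s.2] at h
    have h' : ((Finset.univ.filter fun V : Fin K → Fin (N - 1) → Fin B =>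
        ∀ k ∈ s.1, V k = 0).card : ℝ) * B ^ ((N - 1) * (t + 1)) = B ^ ((N - 1) * K) := by
      exact_mod_cast h
    rw [Finset.sum_sub_distrib, Finset.sum_boole, mul_sub, ← h', mul_comm (t + 1), one_div, inv_pow,
      mul_assoc _ _ (_)⁻¹, mul_inv_cancel₀ (pow_ne_zero _ hB), h']
    simp [← pow_mul]
  rw [Finset.sum_congr rfl fun s _ => h3 s, Finset.sum_const, Finset.card_univ, nsmul_eq_mul,
    Fintype.card_finset_len, Fintype.card_fin]

theorem card_pos (B K t l : ℕ) [NeZero B] :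
    Fintype.card (Pos B {T : Finset (Fin K) // T.card = t} l) = K.choose t * ((B - 1) * l) := by
  classical
  simp [Fintype.card_finset_len, Fintype.card_subtype_compl]

theorem manScheme_rateAt (hB : 2 ≤ B) (hN : 1 ≤ N) (ht : t ≤ K) (hl : 1 ≤ l)
    (d : Fin K → Fin N) :
    (manScheme B N K t l).rateAt d = ((K : ℝ) - t) / (t + 1) *
      ∑ i ∈ Finset.range ((t + 1) * (N - 1) + 1), (1 / (B : ℝ)) ^ i := by
  classical
  have hBpos : (1 : ℝ) < B := by exact_mod_cast hB
  have h1 : (manScheme B N K t l).rateAt d =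
      (∑ V : Fin K → Fin (N - 1) → Fin B, ∑ b,
        (Nat.card (Active (manPDA K t) (pdaQuery d V b)) : ℝ)) * l / B ^ ((N - 1) * K) /
        (K.choose t * (((B : ℝ) - 1) * l)) := by
    have e := sum_map_uniform (pdaQuery (B := B) d) fun q => ∑ b,
      ((manScheme B N K t l).ansLen b (q b) : ℝ)
    have hcard : (Fintype.card (Pos B {T : Finset (Fin K) // T.card = t} l) : ℝ) =
        K.choose t * (((B : ℝ) - 1) * l) := by
      rw [card_pos]
      push_cast [Nat.cast_sub (show 1 ≤ B by omega)]
      rfl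
    rw [← hcard]
    refine congrArg (· / (Fintype.card (Pos B {T : Finset (Fin K) // T.card = t} l) : ℝ))
      (e.trans ?_)
    congr 1
    · rw [Finset.sum_mul]
      refine Finset.sum_congr rfl fun V _ => ?_
      rw [Finset.sum_mul]
      refine Finset.sum_congr rfl fun b _ => ?_
      simp only [manScheme, pdaScheme, ← Nat.card_eq_fintype_card, Nat.card_prod, Nat.cast_mul,
        Nat.card_fin]
    · simp [← pow_mul]
  have hch : (K.choose (t + 1) : ℝ) * (t + 1) = K.choose t * (K - t) := by
    have := Nat.choose_succ_right_eq K t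
    rw [← Nat.cast_sub ht]
    exact_mod_cast this
  have hc0 : (K.choose t : ℝ) ≠ 0 := Nat.cast_ne_zero.2 (Nat.choose_pos ht).ne'
  have hl0 : (l : ℝ) ≠ 0 := Nat.cast_ne_zero.2 (by omega)
  have hB1 : (B : ℝ) - 1 ≠ 0 := by linarith
  have hB0 : (B : ℝ) ≠ 0 := by linarith
  have hchd : (K.choose (t + 1) : ℝ) = K.choose t * (((K : ℝ) - t) / (t + 1)) := by
    field_simp; linarith
  -- The numerator is the expected number of servers that transmit for a given symbol; the
  -- denominator counts the packets of a subfile.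
  have geom : ∑ i ∈ Finset.range ((t + 1) * (N - 1) + 1), (1 / (B : ℝ)) ^ i =
      (B - (1 / B) ^ ((t + 1) * (N - 1))) / (B - 1) := by
    have h := mul_neg_geom_sum (1 / (B : ℝ)) ((t + 1) * (N - 1) + 1)
    rw [eq_div_iff hB1]
    have : ((B : ℝ) - 1) = B * (1 - 1 / B) := by field_simp
    rw [this, mul_comm, mul_assoc, h, pow_succ]
    field_simp
  rw [h1, sum_card_active hN, hchd, geom]
  field_simp

theorem manScheme_rate (hB : 2 ≤ B) (hN : 1 ≤ N) (ht : t ≤ K) (hl : 1 ≤ l) :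
    (manScheme B N K t l).rate = ((K : ℝ) - t) / (t + 1) *
      ∑ i ∈ Finset.range ((t + 1) * (N - 1) + 1), (1 / (B : ℝ)) ^ i := by
  have : Nonempty (Fin K → Fin N) := ⟨fun _ => ⟨0, hN⟩⟩
  rw [Scheme.rate, funext fun d => manScheme_rateAt hB hN ht hl d, ciSup_const]

end Rate

/-! ## Cache sizes -/

section Memory

open Real

variable {N : ℕ} {ι : Type} [Fintype ι]

/-- The bits in `A` and those outside together carry the full entropy of the library, and those
outside carry at most one bit each. -/
theorem card_le_unifEntropy_of_determines [DecidableEq ι] {β : Type} (z : Files N ι → β)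
    (A : Finset (Fin N × ι)) (h : ∀ w w', z w = z w' → ∀ p ∈ A, w p.1 p.2 = w' p.1 p.2) :
    A.card * log 2 ≤ unifEntropy z := by
  let bits : (S : Finset (Fin N × ι)) → Files N ι → S → ZMod 2 := fun S w p => w p.1.1 p.1.2
  have hbits : ∀ S w w', bits S w = bits S w' ↔ ∀ p ∈ S, w p.1 p.2 = w' p.1 p.2 := fun S w w' => by
    simp [bits, funext_iff]
  have h1 : unifEntropy (bits A) ≤ unifEntropy z :=
    unifEntropy_mono fun w w' hz => (hbits A w w').2 (h w w' hz)
  have h2 := unifEntropy_pair_le (bits A) (bits Aᶜ)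
  rw [unifEntropy_of_injective fun w w' hw => ?_] at h2
  · have h3 := unifEntropy_le_log_card (bits Aᶜ)
    have hc : (A.card : ℝ) + (Aᶜ.card : ℝ) = N * Fintype.card ι := by
      have := Finset.card_add_card_compl A
      rw [Fintype.card_prod, Fintype.card_fin] at this
      exact_mod_cast this
    simp only [Fintype.card_fun, ZMod.card, Nat.cast_pow, Nat.cast_ofNat, log_pow,
      Fintype.card_coe, Fintype.card_fin] at h2 h3
    have e : (A.card : ℝ) * log 2 = N * (Fintype.card ι * log 2) - Aᶜ.card * log 2 := by
      rw [← mul_assoc, ← hc]; ring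
    linarith
  · obtain ⟨ha, hb⟩ := Prod.mk.inj hw
    funext n i
    by_cases hA : (n, i) ∈ A
    · exact (hbits A w w').1 ha (n, i) hA
    · exact (hbits Aᶜ w w').1 hb (n, i) (Finset.mem_compl.2 hA)

theorem entropyBits_le_of_card {β : Type} [Fintype β] (z : Files N ι → β) {m : ℕ}
    (h : Fintype.card β = 2 ^ m) : entropyBits z ≤ m := by
  classical
  rw [entropyBits_eq, div_le_iff₀ (log_pos one_lt_two)]
  refine (unifEntropy_le_log_card z).trans_eq ?_
  rw [h, Nat.cast_pow, log_pow, Nat.cast_ofNat]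

theorem unifEntropy_le_of_entropyBits_le [DecidableEq ι] {β : Type} [Fintype β]
    {z : Files N ι → β} {m : ℝ} (h : entropyBits z ≤ m) : unifEntropy z ≤ m * log 2 := by
  rwa [entropyBits_eq, div_le_iff₀ (log_pos one_lt_two)] at h

end Memory

/-! ## Achievability -/

section Achievability

variable {B N K t l : ℕ} [NeZero B]

/-- Both sides count the pairs `k ∈ T`; hence each user stores the fraction `t / K` of every file.
-/
theorem mul_manStars (hK : 1 ≤ K) : K * manStars K t = t * K.choose t := by
  obtain ⟨K, rfl⟩ : ∃ m, K = m + 1 := ⟨K - 1, by omega⟩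
  cases t with
  | zero => simp [manStars]
  | succ t =>
    have := Nat.add_one_mul_choose_eq K t
    simp only [manStars, Nat.add_one_ne_zero, if_false, Nat.add_sub_cancel]
    rw [this, mul_comm]

theorem manScheme_memory (hK : 1 ≤ K) (k : Fin K) :
    entropyBits ((manScheme B N K t l).cache k) ≤
      (t : ℝ) * N / K * Fintype.card (Pos B {T : Finset (Fin K) // T.card = t} l) := by
  classical
  have hK0 : (K : ℝ) ≠ 0 := Nat.cast_ne_zero.2 (by omega)
  refine (entropyBits_le_of_card (m := N * (manStars K t * ((B - 1) * l))) _ ?_).trans_eq ?_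
  · have h := (manPDA K t).star_count k
    rw [Nat.card_eq_fintype_card] at h
    have : Fintype.card ((manScheme B N K t l).Mem k) = Fintype.card (Fin N ×
        {f // (manPDA K t).entry f k = none} × {c : Fin B // c ≠ 0} × Fin l → ZMod 2) :=
      Fintype.card_congr (Equiv.refl _)
    rw [this, Fintype.card_fun, ZMod.card, Fintype.card_prod, Fintype.card_prod, h]
    simp [Fintype.card_subtype_compl]
  · have h : (K : ℝ) * manStars K t = t * K.choose t := by exact_mod_cast mul_manStars hK
    rw [card_pos]
    push_cast
    rw [div_mul_eq_mul_div, eq_div_iff hK0]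
    linear_combination (N : ℝ) * (((B - 1 : ℕ) : ℝ) * l) * h

theorem manScheme_uachievable (hB : 2 ≤ B) (hN : 1 ≤ N) (hK : 1 ≤ K) (ht : t ≤ K) (hl : 1 ≤ l) :
    UAchievable B N K ((t : ℝ) * N / K) (manScheme B N K t l).rate := by
  classical
  refine ⟨_, inferInstance, ?_, manScheme B N K t l, pdaScheme_private hN _, pdaScheme_correct _,
    pdaScheme_isUncoded _, manScheme_memory hK, le_rfl⟩
  rw [← Fintype.card_pos_iff, card_pos]
  exact Nat.mul_pos (Nat.choose_pos ht) (Nat.mul_pos (by omega) hl)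

/-- Every user caches the first `t` of the `K` bits of each file; the other bits of all files are
broadcast by server `0`. -/
noncomputable def directScheme (B N K t : ℕ) [NeZero B] : Scheme B N K (Fin K) where
  Mem _ := Fin N × {i : Fin K // i.1 < t} → ZMod 2
  memFintype _ := inferInstance
  Query := Unit
  queryFintype := inferInstance
  cache _ w := fun p => w p.1 p.2.1
  queryLaw _ := PMF.pure fun _ => ()
  ansLen b _ := Fintype.card {p : Fin N × Fin K // ¬ p.2.1 < t ∧ b = 0}
  answer _ _ w := fun i => w ((Fintype.equivFin _).symm i).1.1 ((Fintype.equivFin _).symm i).1.2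

theorem directScheme_correct : (directScheme B N K t).Correct := by
  intro d q _ k w w' hans hcache
  funext i
  by_cases hi : i.1 < t
  · exact congrFun hcache (d k, ⟨i, hi⟩)
  · have := congrFun (hans 0) (Fintype.equivFin
      {p : Fin N × Fin K // ¬ p.2.1 < t ∧ (0 : Fin B) = 0} ⟨(d k, i), hi, rfl⟩)
    simpa [directScheme] using this

theorem card_fin_lt (ht : t ≤ K) : Fintype.card {i : Fin K // i.1 < t} = t := by
  rw [Fintype.card_subtype]
  have : (Finset.univ.filter fun i : Fin K => i.1 < t) =
      (Finset.univ : Finset (Fin t)).map (Fin.castLEEmb ht) := by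
    ext i
    simp only [Finset.mem_filter, Finset.mem_univ, true_and, Finset.mem_map]
    constructor
    · exact fun h => ⟨⟨i, h⟩, Fin.ext rfl⟩
    · rintro ⟨j, rfl⟩
      exact j.2
  rw [this, Finset.card_map, Finset.card_univ, Fintype.card_fin]

theorem directScheme_rateAt (hK : 1 ≤ K) (ht : t ≤ K) (d : Fin K → Fin N) :
    (directScheme B N K t).rateAt d = (N : ℝ) - t * N / K := by
  classical
  have hK0 : (K : ℝ) ≠ 0 := Nat.cast_ne_zero.2 (by omega)
  have hlen : ∀ b, Fintype.card {p : Fin N × Fin K // ¬ p.2.1 < t ∧ b = (0 : Fin B)} =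
      if b = 0 then N * (K - t) else 0 := by
    intro b
    split_ifs with hb
    · have e : {p : Fin N × Fin K // ¬ p.2.1 < t ∧ b = (0 : Fin B)} ≃
          Fin N × {i : Fin K // ¬ i.1 < t} :=
        { toFun := fun p => (p.1.1, ⟨p.1.2, p.2.1⟩)
          invFun := fun p => ⟨(p.1, p.2.1), p.2.2, hb⟩
          left_inv := fun p => rfl
          right_inv := fun p => rfl }
      rw [Fintype.card_congr e, Fintype.card_prod, Fintype.card_subtype_compl, card_fin_lt ht,
        Fintype.card_fin, Fintype.card_fin]
    · exact Fintype.card_eq_zero_iff.2 ⟨fun p => hb p.2.2⟩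
  have hsum : ∀ q : Fin B → Unit, (∑ b, ((directScheme B N K t).ansLen b (q b) : ℝ)) =
      N * (K - t) := by
    intro q
    calc _ = ∑ b : Fin B, if b = 0 then (N * (K - t) : ℝ) else 0 := by
          refine Finset.sum_congr rfl fun b _ => ?_
          have : (directScheme B N K t).ansLen b (q b) = _ :=
            (Fintype.card_congr (Equiv.refl _)).trans (hlen b)
          rw [this]
          split_ifs
          · push_cast [Nat.cast_sub ht]; rfl
          · simp
      _ = _ := by simp
  have hq : ∀ q : Fin B → Unit, q = fun _ => () := fun q => Subsingleton.elim _ _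
  have h1 : ∑ q : Fin B → Unit, ((directScheme B N K t).queryLaw d q).toReal *
      (∑ b, ((directScheme B N K t).ansLen b (q b) : ℝ)) = N * (K - t) := by
    rw [Fintype.sum_eq_single (fun _ => ()) fun q h => absurd (hq q) h, hsum]
    have : (directScheme B N K t).queryLaw d (fun _ => ()) = 1 := if_pos rfl
    rw [this, ENNReal.toReal_one, one_mul]
  unfold Scheme.rateAt
  refine Eq.trans (congrArg (· / (Fintype.card (Fin K) : ℝ)) h1) ?_
  simp only [Fintype.card_fin]
  field_simp

theorem directScheme_uachievable (hN : 1 ≤ N) (hK : 1 ≤ K) (ht : t ≤ K) :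
    UAchievable B N K ((t : ℝ) * N / K) ((N : ℝ) - t * N / K) := by
  have hK0 : (K : ℝ) ≠ 0 := Nat.cast_ne_zero.2 (by omega)
  have : Nonempty (Fin K → Fin N) := ⟨fun _ => ⟨0, hN⟩⟩
  refine ⟨Fin K, inferInstance, ⟨⟨0, hK⟩⟩, directScheme B N K t, fun _ _ _ => rfl,
    directScheme_correct, fun k => isUncoded_of_bits
      fun p : Fin N × {i : Fin K // i.1 < t} => (p.1, p.2.1), fun k => ?_, ?_⟩
  · refine (entropyBits_le_of_card (m := N * t) _ ?_).trans_eq ?_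
    · have : Fintype.card ((directScheme B N K t).Mem k) =
          Fintype.card (Fin N × {i : Fin K // i.1 < t} → ZMod 2) :=
        Fintype.card_congr (Equiv.refl _)
      rw [this, Fintype.card_fun, ZMod.card, Fintype.card_prod, card_fin_lt ht, Fintype.card_fin]
    · rw [Fintype.card_fin]
      push_cast
      field_simp
  · rw [Scheme.rate, funext fun d => directScheme_rateAt hK ht d, ciSup_const]

/-- Sending all files with empty caches shows that the set of coded caching rates is nonempty. Lower
bounds on `sInf` need this, as `sInf ∅ = 0` in `ℝ`. -/
theorem uccAchievable_all {M : ℝ} (hM : 0 ≤ M) : UCCAchievable N K M N := by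
  refine ⟨Unit, inferInstance, inferInstance,
    ⟨0, N, fun _ _ i => i.elim0, fun _ w n => w n ()⟩, ?_, ?_, by simpa using hM, by simp⟩
  · intro d k w w' h _
    funext i
    exact congrFun h (d k)
  · exact fun k => ⟨∅, fun w w' => by simp⟩

end Achievability

/-! ## Comparison -/

section Comparison

open Real

variable {B N K t l : ℕ} {ι : Type} [Fintype ι]

theorem CCScheme.unifEntropy_cache_le [DecidableEq ι] (C : CCScheme N K ι) {m : ℝ}
    (h : (C.memLen : ℝ) ≤ m) (k : Fin K) : unifEntropy (C.cache k) ≤ m * log 2 :=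
  unifEntropy_le_of_entropyBits_le ((entropyBits_le_of_card _ (by simp)).trans h)

theorem Achievable.nonneg {M R : ℝ} (hN : 1 ≤ N) (h : Achievable B N K M R) : 0 ≤ R := by
  obtain ⟨ι, _, _, C, -, -, -, h⟩ := h
  refine le_trans ?_ ((C.rateAt_le_rate fun _ => ⟨0, hN⟩).trans h)
  exact div_nonneg (Finset.sum_nonneg fun q _ => mul_nonneg ENNReal.toReal_nonneg
    (Finset.sum_nonneg fun b _ => Nat.cast_nonneg _)) (Nat.cast_nonneg _)

theorem UAchievable.achievable {M R : ℝ} (h : UAchievable B N K M R) : Achievable B N K M R :=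
  let ⟨ι, i₁, i₂, C, hp, hc, _, hm, hr⟩ := h
  ⟨ι, i₁, i₂, C, hp, hc, hm, hr⟩

theorem UCCAchievable.ccAchievable {M R : ℝ} (h : UCCAchievable N K M R) : CCAchievable N K M R :=
  let ⟨ι, i₁, i₂, C, hc, _, hm, hr⟩ := h
  ⟨ι, i₁, i₂, C, hc, hm, hr⟩

theorem le_mul_sInf {S : Set ℝ} (hS : S.Nonempty) {a c : ℝ} (hc : 0 < c)
    (h : ∀ R ∈ S, a ≤ c * R) : a ≤ c * sInf S :=
  (div_le_iff₀' hc).1 (le_csInf hS fun R hR => (div_le_iff₀' hc).2 (h R hR))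

variable [NeZero B] [Nonempty ι]

/-- A geometric series of ratio `1 / B ≤ 1 / 2` stays below `2`, which is the whole price of privacy
here. -/
theorem manRate_le (hB : 2 ≤ B) (hN : 1 ≤ N) (ht : t ≤ K) (hl : 1 ≤ l) :
    manRate B N K t l ≤ 2 * (((K : ℝ) - t) / (t + 1)) := by
  have hc : (0 : ℝ) ≤ ((K : ℝ) - t) / (t + 1) :=
    div_nonneg (sub_nonneg.2 (Nat.cast_le.2 ht)) (by positivity)
  refine (min_le_right _ _).trans ?_
  rw [manScheme_rate hB hN ht hl, mul_comm]
  refine mul_le_mul_of_nonneg_right ?_ hc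
  have hB' : (1 : ℝ) / B ≤ 1 / 2 :=
    one_div_le_one_div_of_le two_pos (by exact_mod_cast hB)
  refine (Finset.sum_le_sum fun i _ => pow_le_pow_left₀ (by positivity) hB' i).trans ?_
  exact sum_geometric_two_le _

/-- Any caches and broadcasts, private or not, need at least an eighth of the rate. -/
theorem manRate_le_of_deliverable (hB : 2 ≤ B) (hN : 1 ≤ N) (hK : 1 ≤ K) (ht : t ≤ K)
    (hl : 1 ≤ l) {Mem : Fin K → Type} {cache : ∀ k, Files N ι → Mem k} [DecidableEq ι] {R : ℝ}
    (hM : ∀ k, unifEntropy (cache k) ≤ (t : ℝ) * N / K * Fintype.card ι * log 2)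
    (hR : Deliverable cache (R * Fintype.card ι)) : manRate B N K t l ≤ 8 * R := by
  have hNpos : (1 : ℝ) ≤ N := by exact_mod_cast hN
  have hKpos : (1 : ℝ) ≤ K := by exact_mod_cast hK
  have htK : (t : ℝ) ≤ K := by exact_mod_cast ht
  have hman := manRate_le (N := N) hB hN ht hl
  have hdir : manRate B N K t l ≤ (N : ℝ) - t * N / K := min_le_left _ _
  rcases Nat.eq_zero_or_pos t with h0 | h0
  · subst h0
    -- Without caches nothing leaks, so `min N K ≤ R`, against the rates `N` and `2 * K`.
    have h := coded_converse hN hM hR (min_le_left N K) (min_le_right N K)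
    simp only [Nat.cast_zero, zero_mul, zero_div, mul_zero, sub_zero, Finset.sum_const,
      Finset.card_range, nsmul_eq_mul, mul_one, zero_add, div_one] at h hman hdir
    rcases le_total N K with hNK | hNK
    · rw [min_eq_left hNK] at h; linarith
    · rw [min_eq_right hNK] at h; linarith
  · have ht1 : (1 : ℝ) ≤ t := by exact_mod_cast h0
    set M : ℝ := (t : ℝ) * N / K with hMdef
    have hMK : M * K = t * N := div_mul_cancel₀ _ (by positivity)
    have hM0 : 0 < M := by positivity
    have hMN : M ≤ N := by
      rw [hMdef, div_le_iff₀ (by positivity), mul_comm]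
      exact mul_le_mul_of_nonneg_left htK (by positivity)
    -- Since `M * K = t * N`, the condition reads `N + 1 ≤ t * N + K`, which holds because `t` and
    -- `K` are at least `1`.
    have h := coded_converse_closed hM0.le hMN (by nlinarith) hM hR hN
    have hNM : 0 ≤ (N : ℝ) - M := sub_nonneg.2 hMN
    -- For `M ≤ 3` direct transmission is within `2 * (M + 1) ≤ 8` of the converse. For `M ≥ 3`, `(K
    -- - t) / (t + 1) ≤ (K - t) / t = (N - M) / M`, and `M + 1 ≤ 2 * M` finishes.
    rcases le_total M 3 with h3 | h3
    · have : ((N : ℝ) - M) ≤ 8 * (((N : ℝ) - M) / (2 * (M + 1))) := by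
        rw [← mul_div_assoc, le_div_iff₀ (by positivity)]
        nlinarith
      linarith
    · have h4 : ((K : ℝ) - t) / (t + 1) ≤ (N - M) / M := by
        rw [div_le_div_iff₀ (by positivity) hM0]
        have : ((K : ℝ) - t) * M = (N - M) * t := by linear_combination hMK
        rw [this]
        nlinarith
      have h5 : ((N : ℝ) - M) / M ≤ 4 * ((N - M) / (2 * (M + 1))) := by
        rw [← mul_div_assoc, div_le_div_iff₀ hM0 (by positivity)]
        nlinarith
      linarith

/-- Under uncoded placement, and with at least as many files as users, any caches and broadcasts
need at least half of the rate. -/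
theorem manRate_le_of_deliverable_uncoded (hB : 2 ≤ B) (hN : 1 ≤ N) (hK : 1 ≤ K) (ht : t ≤ K)
    (hl : 1 ≤ l) (hKN : K ≤ N) {Mem : Fin K → Type} {cache : ∀ k, Files N ι → Mem k}
    [DecidableEq ι] {R : ℝ} (hu : ∀ k, IsUncoded (cache k))
    (hM : ∀ k, unifEntropy (cache k) ≤ (t : ℝ) * N / K * Fintype.card ι * log 2)
    (hR : Deliverable cache (R * Fintype.card ι)) : manRate B N K t l ≤ 2 * R := by
  choose A hA using hu
  have h := uncoded_converse (t := t) hK hKN (fun k w w' => (hA k w w').2) (fun k => ?_) hR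
  · exact (manRate_le hB hN ht hl).trans (mul_le_mul_of_nonneg_left h two_pos.le)
  · exact le_of_mul_le_mul_right ((card_le_unifEntropy_of_determines (cache k) (A k)
      fun w w' => (hA k w w').1).trans (hM k)) (log_pos one_lt_two)

end Comparison

end MuPIR

theorem theorem2 (B N K t l : ℕ) [NeZero B] (hB : 2 ≤ B) (hN : 1 ≤ N) (hK : 1 ≤ K) (ht : t ≤ K)
    (hl : 1 ≤ l) (M : ℝ) (hM : M = (t : ℝ) * N / K) :
    -- the rate in closed form
    MuPIR.manRate B N K t l = min ((N : ℝ) - M)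
      (((K : ℝ) - t) / (t + 1) * ∑ i ∈ Finset.range ((t + 1) * (N - 1) + 1), (1 / (B : ℝ)) ^ i) ∧
    -- comparison with the optimal coded caching rates
    MuPIR.manRate B N K t l ≤ 8 * MuPIR.RccStar N K M ∧
    (K ≤ N → MuPIR.manRate B N K t l ≤ 2 * MuPIR.RuccStar N K M) ∧
    -- order optimality among the multi-user PIR schemes
    (MuPIR.RStar B N K M ≤ MuPIR.manRate B N K t l ∧
      MuPIR.manRate B N K t l ≤ 8 * MuPIR.RStar B N K M) ∧
    (MuPIR.RuStar B N K M ≤ MuPIR.manRate B N K t l ∧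
      (K ≤ N → MuPIR.manRate B N K t l ≤ 2 * MuPIR.RuStar B N K M)) := by
  classical
  subst hM
  have hM0 : (0 : ℝ) ≤ (t : ℝ) * N / K := by positivity
  have hman := MuPIR.manScheme_uachievable hB hN hK ht hl
  have hdir := MuPIR.directScheme_uachievable (B := B) hN hK ht
  have hall := MuPIR.uccAchievable_all (N := N) (K := K) hM0
  refine ⟨?_, ?_, fun hKN => ?_, ⟨?_, ?_⟩, ⟨?_, fun hKN => ?_⟩⟩
  · rw [MuPIR.manRate, MuPIR.manScheme_rate hB hN ht hl]
  · refine MuPIR.le_mul_sInf ⟨_, hall.ccAchievable⟩ (by norm_num) ?_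
    rintro R ⟨ι, _, _, C, hC, hm, hR⟩
    exact MuPIR.manRate_le_of_deliverable hB hN hK ht hl (C.unifEntropy_cache_le hm)
      (MuPIR.CCScheme.deliverable hC hR)
  · refine MuPIR.le_mul_sInf ⟨_, hall⟩ (by norm_num) ?_
    rintro R ⟨ι, _, _, C, hC, hu, hm, hR⟩
    exact MuPIR.manRate_le_of_deliverable_uncoded hB hN hK ht hl hKN hu
      (C.unifEntropy_cache_le hm) (MuPIR.CCScheme.deliverable hC hR)
  · have hbdd : BddBelow {R | MuPIR.Achievable B N K ((t : ℝ) * N / K) R} :=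
      ⟨0, fun R h => h.nonneg hN⟩
    exact le_min (csInf_le hbdd hdir.achievable) (csInf_le hbdd hman.achievable)
  · refine MuPIR.le_mul_sInf ⟨_, hdir.achievable⟩ (by norm_num) ?_
    rintro R ⟨ι, _, _, C, -, hC, hm, hR⟩
    exact MuPIR.manRate_le_of_deliverable hB hN hK ht hl
      (fun k => MuPIR.unifEntropy_le_of_entropyBits_le (hm k)) (MuPIR.Scheme.deliverable hC hR)
  · have hbdd : BddBelow {R | MuPIR.UAchievable B N K ((t : ℝ) * N / K) R} :=
      ⟨0, fun R h => h.achievable.nonneg hN⟩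
    exact le_min (csInf_le hbdd hdir) (csInf_le hbdd hman)
  · refine MuPIR.le_mul_sInf ⟨_, hdir⟩ (by norm_num) ?_
    rintro R ⟨ι, _, _, C, -, hC, hu, hm, hR⟩
    exact MuPIR.manRate_le_of_deliverable_uncoded hB hN hK ht hl hKN hu
      (fun k => MuPIR.unifEntropy_le_of_entropyBits_le (hm k)) (MuPIR.Scheme.deliverable hC hR)
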